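/- Bimodal formulas are built from propositional variables \(P_0,P_1,P_2,\dots\) by \(\neg\), \(\wedge\), \(\Diamond_0\), \(\Diamond_1\), and are evaluated in the usual way in models on 2-frames \(\langle W,R_0,R_1\rangle\) (\(W\neq\emptyset\)), with \(\Diamond_i\) interpreted by \(R_i\). Let \(\{\langle\omega,<\rangle\}\times^{e}\mathcal C_{\mathrm{diff}}\) be the class of all 2-frames obtained as follows: take non-empty sets \((W_n)_{n<\omega}\) with \(W_m\subseteq W_n\) whenever \(m<n\) (so that the difference frame \(\langle W_m,\neq\rangle\) is a subframe of \(\langle W_n,\neq\rangle\)); the points are the pairs \(\langle n,a\rangle\) with \(n<\omega\) and \(a\in W_n\); \(\langle m,a\rangle R_0\langle n,b\rangle\) iff \(m<n\) and \(a=b\); and \(\langle m,a\rangle R_1\langle n,b\rangle\) iff \(m=n\) and \(a\neq b\). (i) The following problem is undecidable: given a bimodal formula \(\phi\), is \(\phi\) true at some point of some model based on a 2-frame in \(\{\langle\omega,<\rangle\}\times^{e}\mathcal C_{\mathrm{diff}}\)? (ii) Consequently, satisfiability of one-variable first-order linear temporal logic with counting to two (\(\mathrm{FOLTL}^{\neq}\))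 in expanding domain models over \(\langle\omega,<\rangle\) is undecidable. Here formulas are built from atoms \(P_i(x)\) with monadic predicate symbols \(P_0,P_1,P_2,\dots\) by \(\neg\), \(\wedge\), \(\Diamond_F\) and \(\exists^{\neq}x\). A model has non-empty domains \(D_t\) (\(t<\omega\)) with \(D_t\subseteq D_{t'}\) for \(t<t'\), and interpretations \(P_i^{I(t)}\subseteq D_t\). For \(a\in D_t\), \(t\models^a P_i(x)\) iff \(a\in P_i^{I(t)}\); the Booleans are as usual; \(t\models^a\Diamond_F\phi\) iff \(t'\models^a\phi\) for some \(t'>t\) with \(a\in D_{t'}\); and \(t\models^a\exists^{\neq}x\,\phi\) iff \(t\models^b\phi\) for some \(b\in D_t\) with \(b\neq a\). The formula \(\phi\) is satisfiable if \(t\models^a\phi\) for some such model, some \(t\) and some \(a\in D_t\). -/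

import Mathlib

universe u v

namespace BimodalLogic

/-! ### Bimodal formulas -/

/-- Bimodal formulas over the propositional variables `P₀, P₁, P₂, …`. -/
inductive Formula : Type
  | var : ℕ → Formula
  | neg : Formula → Formula
  | and : Formula → Formula → Formula
  | dia0 : Formula → Formula
  | dia1 : Formula → Formula

namespace Formula

/-- Gödel numbering of bimodal formulas: the residue modulo `5` is the outermost constructor, and
the quotient codes its arguments. -/
def toNat : Formula → ℕ
  | var n => 5 * n
  | neg φ => 5 * toNat φ + 1
  | and φ ψ => 5 * Nat.pair (toNat φ) (toNat ψ) + 2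
  | dia0 φ => 5 * toNat φ + 3
  | dia1 φ => 5 * toNat φ + 4

/-- The formula with a given Gödel number. -/
def ofNat (n : ℕ) : Formula :=
  if n % 5 = 0 then var (n / 5)
  else if n % 5 = 1 then neg (ofNat (n / 5))
  else if n % 5 = 2 then and (ofNat (n / 5).unpair.1) (ofNat (n / 5).unpair.2)
  else if n % 5 = 3 then dia0 (ofNat (n / 5))
  else dia1 (ofNat (n / 5))
termination_by n
decreasing_by
  all_goals
    have h1 : n / 5 < n := by omega
    first
      | exact h1
      | exact lt_of_le_of_lt (Nat.unpair_left_le _) h1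
      | exact lt_of_le_of_lt (Nat.unpair_right_le _) h1

theorem ofNat_toNat (φ : Formula) : ofNat (toNat φ) = φ := by
  induction φ with
  | var n => rw [toNat, ofNat]; simp
  | neg φ ih =>
    have h : (5 * toNat φ + 1) % 5 = 1 := by omega
    have h' : (5 * toNat φ + 1) / 5 = toNat φ := by omega
    rw [toNat, ofNat]; simp [h, h', ih]
  | and φ ψ ih1 ih2 =>
    have h : (5 * Nat.pair (toNat φ) (toNat ψ) + 2) % 5 = 2 := by omega
    have h' : (5 * Nat.pair (toNat φ) (toNat ψ) + 2) / 5 = Nat.pair (toNat φ) (toNat ψ) := by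
      omega
    rw [toNat, ofNat]; simp [h, h', ih1, ih2]
  | dia0 φ ih =>
    have h : (5 * toNat φ + 3) % 5 = 3 := by omega
    have h' : (5 * toNat φ + 3) / 5 = toNat φ := by omega
    rw [toNat, ofNat]; simp [h, h', ih]
  | dia1 φ ih =>
    have h : (5 * toNat φ + 4) % 5 = 4 := by omega
    have h' : (5 * toNat φ + 4) / 5 = toNat φ := by omega
    rw [toNat, ofNat]; simp [h, h', ih]

theorem toNat_ofNat (n : ℕ) : toNat (ofNat n) = n := by
  induction n using Nat.strong_induction_on with
  | _ n ih =>
    have key : n % 5 ≠ 0 → toNat (ofNat (n / 5)) = n / 5 := fun h => ih _ (by omega)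
    have key1 : n % 5 ≠ 0 → toNat (ofNat (n / 5).unpair.1) = (n / 5).unpair.1 := fun h =>
      ih _ (lt_of_le_of_lt (Nat.unpair_left_le _) (by omega))
    have key2 : n % 5 ≠ 0 → toNat (ofNat (n / 5).unpair.2) = (n / 5).unpair.2 := fun h =>
      ih _ (lt_of_le_of_lt (Nat.unpair_right_le _) (by omega))
    rw [ofNat]
    split_ifs with h0 h1 h2 h3
    · simp only [toNat]; omega
    · simp only [toNat]; rw [key h0]; omega
    · simp only [toNat]; rw [key1 h0, key2 h0, Nat.pair_unpair]; omega
    · simp only [toNat]; rw [key h0]; omega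
    · simp only [toNat]; rw [key h0]; omega

/-- Decision problems about formulas are decision problems about their Gödel numbers. -/
instance : Denumerable Formula :=
  Denumerable.mk' ⟨toNat, ofNat, ofNat_toNat, toNat_ofNat⟩

end Formula

/-! ### 2-frames and satisfaction -/

/-- A 2-frame: a non-empty set with two binary relations. -/
structure TwoFrame : Type (u + 1) where
  W : Type u
  nonempty : Nonempty W
  R0 : W → W → Prop
  R1 : W → W → Prop

/-- Truth at the point `w` of the model on the 2-frame `𝔉` with valuation `ν`. -/
def TwoFrame.Sat (𝔉 : TwoFrame.{u}) (ν : ℕ → Set 𝔉.W) : 𝔉.W → Formula → Prop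
  | w, .var n => w ∈ ν n
  | w, .neg φ => ¬ 𝔉.Sat ν w φ
  | w, .and φ ψ => 𝔉.Sat ν w φ ∧ 𝔉.Sat ν w ψ
  | w, .dia0 φ => ∃ v, 𝔉.R0 w v ∧ 𝔉.Sat ν v φ
  | w, .dia1 φ => ∃ v, 𝔉.R1 w v ∧ 𝔉.Sat ν v φ

/-- `𝒞`-satisfiability, for a class `𝒞` of 2-frames. -/
def Satisfiable (𝒞 : Set TwoFrame.{u}) (φ : Formula) : Prop :=
  ∃ 𝔉 ∈ 𝒞, ∃ (ν : ℕ → Set 𝔉.W) (w : 𝔉.W), 𝔉.Sat ν w φ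

/-! ### Frames, subframes, expanding 2-frames -/

/-- A unimodal frame `⟨W, R⟩` whose points come from the type `V`: a non-empty set `W` of elements
of `V` and a relation `R ⊆ W × W`. -/
structure Frame (V : Type u) where
  carrier : Set V
  nonempty : carrier.Nonempty
  rel : V → V → Prop
  mem_of_rel : ∀ x y, rel x y → x ∈ carrier ∧ y ∈ carrier

/-- `𝔉 = ⟨W, R⟩` is a subframe of `𝔊 = ⟨U, S⟩` if `W ⊆ U` and `R = S ∩ (W × W)`. -/
def Frame.IsSubframe {V : Type u} (𝔉 𝔊 : Frame V) : Prop :=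
  𝔉.carrier ⊆ 𝔊.carrier ∧
    ∀ x y, 𝔉.rel x y ↔ 𝔊.rel x y ∧ x ∈ 𝔉.carrier ∧ y ∈ 𝔉.carrier

/-- The 2-frame built from a horizontal frame `𝔉` and vertical frames `𝔊 x`, for `x` in `𝔉`. -/
def twoDim {U : Type u} {V : Type v} (𝔉 : Frame U) (𝔊 : 𝔉.carrier → Frame V) :
    TwoFrame.{max u v} where
  W := {p : 𝔉.carrier × V // p.2 ∈ (𝔊 p.1).carrier}
  nonempty :=
    ⟨⟨(⟨𝔉.nonempty.some, 𝔉.nonempty.some_mem⟩, (𝔊 _).nonempty.some),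
      (𝔊 ⟨𝔉.nonempty.some, 𝔉.nonempty.some_mem⟩).nonempty.some_mem⟩⟩
  R0 p q := 𝔉.rel p.1.1 q.1.1 ∧ p.1.2 = q.1.2
  R1 p q := (𝔊 p.1.1).rel p.1.2 q.1.2 ∧ p.1.1 = q.1.1

/-- The condition for `twoDim 𝔉 𝔊` to be an expanding 2-frame. -/
def IsExpanding {U : Type u} {V : Type v} (𝔉 : Frame U) (𝔊 : 𝔉.carrier → Frame V) : Prop :=
  ∀ x y : 𝔉.carrier, 𝔉.rel x y → (𝔊 x).IsSubframe (𝔊 y)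

/-- The class `𝒞₀ ×ᵉ 𝒞₁` of expanding 2-frames with horizontal component in `𝒞₀` and all vertical
components in `𝒞₁`. The vertical frames have points in a common type `V`, which is arbitrary. -/
def expandingProduct {U : Type u} (𝒞₀ : Set (Frame U)) (𝒞₁ : ∀ V : Type v, Set (Frame V)) :
    Set TwoFrame.{max u v} :=
  {ℌ | ∃ (V : Type v) (𝔉 : Frame U) (𝔊 : 𝔉.carrier → Frame V),
    𝔉 ∈ 𝒞₀ ∧ (∀ x, 𝔊 x ∈ 𝒞₁ V) ∧ IsExpanding 𝔉 𝔊 ∧ ℌ = twoDim 𝔉 𝔊}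

/-- The frame `⟨ω, <⟩`. -/
def omegaFrame : Frame ℕ where
  carrier := Set.univ
  nonempty := Set.univ_nonempty
  rel m n := m < n
  mem_of_rel _ _ _ := ⟨trivial, trivial⟩

/-- The class of all difference frames `⟨W, ≠⟩`. -/
def diffFrames (V : Type v) : Set (Frame V) :=
  {𝔊 | ∀ x y, 𝔊.rel x y ↔ x ∈ 𝔊.carrier ∧ y ∈ 𝔊.carrier ∧ x ≠ y}

end BimodalLogic

/-! ### One-variable first-order linear temporal logic with counting to two -/

namespace FOLTL

/-- FOLTL≠-formulas over the monadic predicate symbols `P₀, P₁, P₂, …`. -/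
inductive Formula : Type
  | pred : ℕ → Formula
  | neg : Formula → Formula
  | and : Formula → Formula → Formula
  | diaF : Formula → Formula
  | existsNe : Formula → Formula

namespace Formula

/-- The syntactic bijection between FOLTL≠-formulas and bimodal formulas. -/
def star : Formula → BimodalLogic.Formula
  | pred n => .var n
  | neg φ => .neg (star φ)
  | and φ ψ => .and (star φ) (star ψ)
  | diaF φ => .dia0 (star φ)
  | existsNe φ => .dia1 (star φ)

/-- The inverse of `star`. -/
def unstar : BimodalLogic.Formula → Formula
  | .var n => pred n
  | .neg φ => neg (unstar φ)
  | .and φ ψ => and (unstar φ) (unstar ψ)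
  | .dia0 φ => diaF (unstar φ)
  | .dia1 φ => existsNe (unstar φ)

theorem unstar_star (φ : Formula) : unstar (star φ) = φ := by
  induction φ <;> simp_all [star, unstar]

theorem star_unstar (φ : BimodalLogic.Formula) : star (unstar φ) = φ := by
  induction φ <;> simp_all [star, unstar]

/-- The Gödel number of a FOLTL≠-formula is that of the corresponding bimodal formula. -/
instance : Denumerable Formula :=
  Denumerable.ofEquiv BimodalLogic.Formula ⟨star, unstar, unstar_star, star_unstar⟩

end Formula

/-- A FOLTL-model based on the linear order `T`, with domain elements from the type `V`. -/
structure Model (T : Type u) [LinearOrder T] (V : Type v) where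
  dom : T → Set V
  dom_nonempty : ∀ t, (dom t).Nonempty
  interp : T → ℕ → Set V
  interp_subset : ∀ t n, interp t n ⊆ dom t

/-- Expanding domain models. -/
def Model.IsExpanding {T : Type u} [LinearOrder T] {V : Type v} (𝔐 : Model T V) : Prop :=
  ∀ t t' : T, t < t' → 𝔐.dom t ⊆ 𝔐.dom t'

/-- The truth relation `t ⊨ᵃ φ` (of interest for `a ∈ dom t`). -/
def Model.Sat {T : Type u} [LinearOrder T] {V : Type v} (𝔐 : Model T V) :
    T → V → Formula → Prop
  | t, a, .pred n => a ∈ 𝔐.interp t n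
  | t, a, .neg φ => ¬ 𝔐.Sat t a φ
  | t, a, .and φ ψ => 𝔐.Sat t a φ ∧ 𝔐.Sat t a ψ
  | t, a, .diaF φ => ∃ t', t < t' ∧ a ∈ 𝔐.dom t' ∧ 𝔐.Sat t' a φ
  | t, a, .existsNe φ => ∃ b ∈ 𝔐.dom t, b ≠ a ∧ 𝔐.Sat t b φ

/-- FOLTL≠-satisfiability in expanding domain models over the linear order `T`, with domains from
the universe `Type v`. -/
def ExpandingSatisfiable (T : Type u) [LinearOrder T] (φ : Formula) : Prop :=
  ∃ (V : Type v) (𝔐 : Model T V), 𝔐.IsExpanding ∧ ∃ t, ∃ a ∈ 𝔐.dom t, 𝔐.Sat t a φ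

end FOLTL

/-! ### Defined connectives of FOLTL≠ -/

namespace FOLTL

namespace Formula

/-! The two satisfiability problems differ only by the renaming `star` (`satisfiable_star_iff`), so
FOLTL is the one treated. A counter machine with undecidable halting set is fixed, and each input
`n` is sent primitive recursively to a formula `describe … n` that is satisfiable iff the machine
does not halt on `n`.

A model encodes an infinite run of a counter system: at each moment a unique element, the tick,
carries the control state, and the value of a counter is the number of elements labelled by it.
Counting to two makes the tick unique and lets at most one element leave a counter per step. Extra
elements joining a counter are not excluded, so a model yields only a faulty run, in which counters
may spontaneously increase (`exists_isFaultyRun`). An exact run does yield a model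
(`expandingSatisfiable_describe`). What is needed is a system that has an exact fair run if the
machine diverges, and not even a faulty one if it halts.

Such a system runs the machine backwards in recurring phases. A phase begins with at least as many
tokens as the current goal, and the goal grows with every phase (`GoalInv.step`). The tokens are
guessed to form a late configuration whose budget of free tokens is used up, and machine steps are
undone until the initial configuration is reached. Undoing conserves tokens. One token is then
removed and the simulation is repeated, until only the input is left.

If the machine diverges, a budget of any size can be exhausted, so all phases succeed
(`exists_isExactRun`). Suppose it halts after `T` steps. Errors only add tokens as time passes, so
bounds on their number propagate from the end of a phase to its beginning. A simulation that starts
with as many tokens as the bound allows at its end is free of errors, hence a genuine computation of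
fewer than `T` steps; so it starts with fewer than `T + n` tokens (`bounded`). Removing tokens one
at a time keeps the total from ever passing this barrier. The growing goal eventually exceeds it,
and the run cannot go on (`not_halts_of_isFair`).

The machine searches for a zero of a primitive recursive function: structured programs compute such
functions (`exists_computes`), and they compile to instructions (`Run.exists_iterate`). -/

def top : Formula := neg (and (pred 0) (neg (pred 0)))

def imp (φ ψ : Formula) : Formula := neg (and φ (neg ψ))

def boxF (φ : Formula) : Formula := neg (diaF (neg φ))

/-- `φ` holds of some element of the current domain. -/
def somewhere (φ : Formula) : Formula := neg (and (neg φ) (neg (existsNe φ)))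

/-- `φ` holds of all elements of the current domain. -/
def everywhere (φ : Formula) : Formula := neg (somewhere (neg φ))

open scoped Classical in
/-- `φ` if the (metatheoretic) proposition `p` holds, and `⊤` otherwise. -/
noncomputable def whenever (p : Prop) (φ : Formula) : Formula := if p then φ else top

/-- The conjunction of a finite family of formulas. -/
noncomputable def conjAll {ι : Type*} [Finite ι] (f : ι → Formula) : Formula :=
  ((Set.finite_univ (α := ι)).toFinset.toList.map f).foldr and top

/-- The disjunction of a finite family of formulas. -/
noncomputable def disjAny {ι : Type*} [Finite ι] (f : ι → Formula) : Formula :=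
  neg (conjAll fun i => neg (f i))

end Formula

namespace Model

open Formula

variable {T : Type u} [LinearOrder T] {V : Type v} {𝔐 : Model T V} {t : T} {a : V}

@[simp] theorem sat_pred {n : ℕ} : 𝔐.Sat t a (pred n) ↔ a ∈ 𝔐.interp t n := Iff.rfl

@[simp] theorem sat_neg {φ : Formula} : 𝔐.Sat t a (neg φ) ↔ ¬ 𝔐.Sat t a φ := Iff.rfl

@[simp] theorem sat_and {φ ψ : Formula} :
    𝔐.Sat t a (and φ ψ) ↔ 𝔐.Sat t a φ ∧ 𝔐.Sat t a ψ := Iff.rfl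

@[simp] theorem sat_diaF {φ : Formula} :
    𝔐.Sat t a (diaF φ) ↔ ∃ t', t < t' ∧ a ∈ 𝔐.dom t' ∧ 𝔐.Sat t' a φ := Iff.rfl

@[simp] theorem sat_existsNe {φ : Formula} :
    𝔐.Sat t a (existsNe φ) ↔ ∃ b ∈ 𝔐.dom t, b ≠ a ∧ 𝔐.Sat t b φ := Iff.rfl

@[simp] theorem sat_top : 𝔐.Sat t a top := by simp [top]

@[simp] theorem sat_imp {φ ψ : Formula} :
    𝔐.Sat t a (imp φ ψ) ↔ (𝔐.Sat t a φ → 𝔐.Sat t a ψ) := by simp [imp]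

theorem sat_boxF {φ : Formula} :
    𝔐.Sat t a (boxF φ) ↔ ∀ t', t < t' → a ∈ 𝔐.dom t' → 𝔐.Sat t' a φ := by simp [boxF]

theorem sat_somewhere {φ : Formula} (ha : a ∈ 𝔐.dom t) :
    𝔐.Sat t a (somewhere φ) ↔ ∃ b ∈ 𝔐.dom t, 𝔐.Sat t b φ := by
  simp only [somewhere, sat_neg, sat_and, sat_existsNe, not_and, not_not]
  constructor
  · intro h
    by_cases h0 : 𝔐.Sat t a φ
    · exact ⟨a, ha, h0⟩
    · obtain ⟨b, hb, -, h1⟩ := h h0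
      exact ⟨b, hb, h1⟩
  · rintro ⟨b, hb, h1⟩ h0
    exact ⟨b, hb, fun h => h0 (h ▸ h1), h1⟩

theorem sat_everywhere {φ : Formula} (ha : a ∈ 𝔐.dom t) :
    𝔐.Sat t a (everywhere φ) ↔ ∀ b ∈ 𝔐.dom t, 𝔐.Sat t b φ := by
  simp [everywhere, sat_somewhere ha]

@[simp] theorem sat_whenever {p : Prop} {φ : Formula} :
    𝔐.Sat t a (whenever p φ) ↔ (p → 𝔐.Sat t a φ) := by
  unfold whenever
  split_ifs with h <;> simp [h]

@[simp] theorem sat_conjAll {ι : Type*} [Finite ι] {f : ι → Formula} :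
    𝔐.Sat t a (conjAll f) ↔ ∀ i, 𝔐.Sat t a (f i) := by
  have key : ∀ l : List ι, 𝔐.Sat t a ((l.map f).foldr and top) ↔ ∀ i ∈ l, 𝔐.Sat t a (f i) := by
    intro l
    induction l with
    | nil => simp
    | cons i l ih => simp [ih]
  simp [conjAll, key]

@[simp] theorem sat_disjAny {ι : Type*} [Finite ι] {f : ι → Formula} :
    𝔐.Sat t a (disjAny f) ↔ ∃ i, 𝔐.Sat t a (f i) := by
  simp [disjAny]

end Model

/-! ### Computability of the constructors -/

namespace Formula

theorem primrec_neg : Primrec neg := by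
  refine Primrec.encode_iff.1 ?_
  have h : (fun φ : Formula => Encodable.encode (neg φ)) =
      fun φ => 5 * Encodable.encode φ + 1 := rfl
  rw [h]
  exact Primrec.nat_add.comp (Primrec.nat_mul.comp (.const 5) .encode) (.const 1)

theorem primrec_and : Primrec₂ and := by
  refine Primrec.encode_iff.1 ?_
  have h : (fun p : Formula × Formula => Encodable.encode (and p.1 p.2)) =
      fun p => 5 * Nat.pair (Encodable.encode p.1) (Encodable.encode p.2) + 2 := rfl
  rw [h]
  exact Primrec.nat_add.comp (Primrec.nat_mul.comp (.const 5) (Primrec₂.natPair.comp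
    (Primrec.encode.comp .fst) (Primrec.encode.comp .snd))) (.const 2)

theorem primrec_diaF : Primrec diaF := by
  refine Primrec.encode_iff.1 ?_
  have h : (fun φ : Formula => Encodable.encode (diaF φ)) =
      fun φ => 5 * Encodable.encode φ + 3 := rfl
  rw [h]
  exact Primrec.nat_add.comp (Primrec.nat_mul.comp (.const 5) .encode) (.const 3)

theorem primrec_existsNe : Primrec existsNe := by
  refine Primrec.encode_iff.1 ?_
  have h : (fun φ : Formula => Encodable.encode (existsNe φ)) =
      fun φ => 5 * Encodable.encode φ + 4 := rfl
  rw [h]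
  exact Primrec.nat_add.comp (Primrec.nat_mul.comp (.const 5) .encode) (.const 4)

theorem primrec_star : Primrec star :=
  Primrec.encode_iff.1 (Primrec.encode : Primrec (Encodable.encode : Formula → ℕ))

end Formula

/-! ### Expanding domain models and expanding 2-frames -/

open BimodalLogic in
theorem satisfiable_star_iff (φ : Formula) :
    Satisfiable (expandingProduct {omegaFrame} diffFrames.{v}) φ.star ↔
      ExpandingSatisfiable.{0, v} ℕ φ := by
  constructor
  · rintro ⟨_, ⟨V, 𝔉, 𝔊, rfl, hdiff, hexp, rfl⟩, ν, w, hw⟩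
    let pt : ℕ → omegaFrame.carrier := fun t => ⟨t, trivial⟩
    let 𝔐 : Model ℕ V :=
      { dom := fun t => (𝔊 (pt t)).carrier
        dom_nonempty := fun t => (𝔊 (pt t)).nonempty
        interp := fun t n => {a | ∃ h : a ∈ (𝔊 (pt t)).carrier, ⟨(pt t, a), h⟩ ∈ ν n}
        interp_subset := fun t n a ha => ha.1 }
    have key : ∀ (ψ : Formula) (t : ℕ) (a : V) (h : a ∈ (𝔊 (pt t)).carrier),
        (twoDim omegaFrame 𝔊).Sat ν ⟨(pt t, a), h⟩ ψ.star ↔ 𝔐.Sat t a ψ := by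
      intro ψ
      induction ψ with
      | pred n => exact fun t a h => ⟨fun h' => ⟨h, h'⟩, fun h' => h'.2⟩
      | neg ψ ih => exact fun t a h => not_congr (ih t a h)
      | and ψ χ ih1 ih2 => exact fun t a h => and_congr (ih1 t a h) (ih2 t a h)
      | diaF ψ ih =>
        intro t a h
        constructor
        · rintro ⟨⟨⟨⟨t', _⟩, b⟩, hb⟩, ⟨hlt, hab⟩, hs⟩
          obtain rfl : a = b := hab
          exact ⟨t', hlt, hb, (ih t' a hb).1 hs⟩
        · rintro ⟨t', hlt, hb, hs⟩
          exact ⟨⟨(pt t', a), hb⟩, ⟨hlt, rfl⟩, (ih t' a hb).2 hs⟩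
      | existsNe ψ ih =>
        intro t a h
        constructor
        · rintro ⟨⟨⟨⟨t', _⟩, b⟩, hb⟩, ⟨hr, htt⟩, hs⟩
          obtain rfl : t = t' := congrArg Subtype.val htt
          exact ⟨b, hb, fun e => ((hdiff _ _ _).1 hr).2.2 e.symm, (ih t b hb).1 hs⟩
        · rintro ⟨b, hb, hne, hs⟩
          exact ⟨⟨(pt t, b), hb⟩, ⟨(hdiff _ _ _).2 ⟨h, hb, hne.symm⟩, rfl⟩, (ih t b hb).2 hs⟩
    obtain ⟨⟨⟨t, _⟩, a⟩, ha⟩ := w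
    exact ⟨V, 𝔐, fun t t' h => (hexp (pt t) (pt t') h).1, t, a, ha, (key φ t a ha).1 hw⟩
  · rintro ⟨V, 𝔐, hexp, t, a, ha, hs⟩
    let 𝔊 : omegaFrame.carrier → Frame V := fun t =>
      { carrier := 𝔐.dom t.1
        nonempty := 𝔐.dom_nonempty t.1
        rel := fun x y => x ∈ 𝔐.dom t.1 ∧ y ∈ 𝔐.dom t.1 ∧ x ≠ y
        mem_of_rel := fun x y h => ⟨h.1, h.2.1⟩ }
    let ν : ℕ → Set (twoDim omegaFrame 𝔊).W := fun n => {p | p.1.2 ∈ 𝔐.interp p.1.1.1 n}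
    have key : ∀ (ψ : Formula) (t : ℕ) (a : V) (h : a ∈ 𝔐.dom t),
        (twoDim omegaFrame 𝔊).Sat ν ⟨(⟨t, trivial⟩, a), h⟩ ψ.star ↔ 𝔐.Sat t a ψ := by
      intro ψ
      induction ψ with
      | pred n => exact fun t a h => Iff.rfl
      | neg ψ ih => exact fun t a h => not_congr (ih t a h)
      | and ψ χ ih1 ih2 => exact fun t a h => and_congr (ih1 t a h) (ih2 t a h)
      | diaF ψ ih =>
        intro t a h
        constructor
        · rintro ⟨⟨⟨⟨t', _⟩, b⟩, hb⟩, ⟨hlt, hab⟩, hs⟩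
          obtain rfl : a = b := hab
          exact ⟨t', hlt, hb, (ih t' a hb).1 hs⟩
        · rintro ⟨t', hlt, hb, hs⟩
          exact ⟨⟨(⟨t', trivial⟩, a), hb⟩, ⟨hlt, rfl⟩, (ih t' a hb).2 hs⟩
      | existsNe ψ ih =>
        intro t a h
        constructor
        · rintro ⟨⟨⟨⟨t', _⟩, b⟩, hb⟩, ⟨hr, htt⟩, hs⟩
          obtain rfl : t = t' := congrArg Subtype.val htt
          exact ⟨b, hb, fun e => hr.2.2 e.symm, (ih t b hb).1 hs⟩
        · rintro ⟨b, hb, hne, hs⟩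
          exact ⟨⟨(⟨t, trivial⟩, b), hb⟩, ⟨⟨h, hb, hne.symm⟩, rfl⟩, (ih t b hb).2 hs⟩
    refine ⟨_, ⟨V, omegaFrame, 𝔊, rfl, fun t x y => Iff.rfl, ?_, rfl⟩, ν,
      ⟨(⟨t, trivial⟩, a), ha⟩, (key φ t a ha).2 hs⟩
    intro x y hxy
    have hsub : 𝔐.dom x.1 ⊆ 𝔐.dom y.1 := hexp _ _ hxy
    refine ⟨hsub, fun p q => ⟨fun h => ⟨⟨hsub h.1, hsub h.2.1, h.2.2⟩, h.1, h.2.1⟩, ?_⟩⟩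
    exact fun h => ⟨h.2.1, h.2.2, h.1.2.2⟩

end FOLTL

/-! ### Counter systems -/

namespace CounterSystem

/-- The effect of a transition: the counters in `zero` are tested for zero, while `dec` is
decremented and `inc` is incremented. -/
structure Op (K : Type) where
  zero : Set K
  dec : Option K
  inc : Option K

instance {K : Type} [Finite K] : Finite (Op K) :=
  Finite.of_injective (fun o : Op K => (o.zero, o.dec, o.inc)) (by
    rintro ⟨_, _, _⟩ ⟨_, _, _⟩ h
    simpa using h)

open scoped Classical in
/-- `1` if `o` is the counter `i`, and `0` otherwise. -/
noncomputable def one {K A : Type} [Zero A] [One A] (o : Option K) (i : K) : A :=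
  if o = some i then 1 else 0

variable {Q K : Type}

/-- A sequence of states visits `fin` infinitely often, and every visit to `enter` is followed by
exactly `n` visits to `wait` and a visit to `leave`. -/
structure IsFair (enter wait leave fin : Q) (n : ℕ) (q : ℕ → Q) : Prop where
  recurs : ∀ t, ∃ t', t < t' ∧ q t' = fin
  waits : ∀ t, q t = enter → (∀ j < n, q (t + 1 + j) = wait) ∧ q (t + 1 + n) = leave

/-- An infinite run in which counters may spontaneously increase. -/
structure IsFaultyRun (Tr : Q → Op K → Q → Prop) (q : ℕ → Q) (o : ℕ → Op K)
    (c : ℕ → K → ℕ∞) : Prop where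
  tr : ∀ t, Tr (q t) (o t) (q (t + 1))
  zero : ∀ t, ∀ i ∈ (o t).zero, c t i = 0
  le : ∀ t i, c t i + one (o t).inc i ≤ c (t + 1) i + one (o t).dec i

/-- An infinite run without errors, from counters that are all zero. -/
structure IsExactRun (Tr : Q → Op K → Q → Prop) (q : ℕ → Q) (o : ℕ → Op K)
    (c : ℕ → K → ℕ) : Prop where
  tr : ∀ t, Tr (q t) (o t) (q (t + 1))
  zero : ∀ t, ∀ i ∈ (o t).zero, c t i = 0
  dec : ∀ t i, (o t).dec = some i → c t i ≠ 0
  eq : ∀ t i, c (t + 1) i + one (o t).dec i = c t i + one (o t).inc i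
  start : ∀ i, c 0 i = 0

end CounterSystem

/-! ### Describing counter systems by formulas -/

namespace FOLTL

open CounterSystem

variable {Q K : Type} [Encodable Q] [Encodable K]

namespace Formula

/-- The element representing the current time. -/
def tick : Formula := pred (Encodable.encode (none : Option (Q ⊕ K)))

/-- The current state is `q`; evaluated at the element representing the current time. -/
def state (q : Q) : Formula := pred (Encodable.encode (some (.inl q) : Option (Q ⊕ K)))

/-- The element currently contributes to the counter `i`. -/
def counts (i : K) : Formula := pred (Encodable.encode (some (.inr i) : Option (Q ⊕ K)))

/-- `φ` holds at the element representing the next moment, at that moment. -/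
def nextTick (φ : Formula) : Formula :=
  somewhere (and (diaF (and (tick (Q := Q) (K := K)) φ))
    (neg (diaF (diaF (tick (Q := Q) (K := K))))))

/-- Off now, on later. Forbidding this in the future of every counting element makes the times at
which an element counts an interval. -/
def before (i : K) : Formula := and (neg (counts (Q := Q) i)) (diaF (counts (Q := Q) i))

/-- An element still off at the next moment would satisfy `before` there, so counting begins exactly
at the next moment. -/
def starts (i : K) : Formula := and (before (Q := Q) i) (neg (diaF (before (Q := Q) i)))

def ends (i : K) : Formula := and (counts (Q := Q) i) (neg (diaF (counts (Q := Q) i)))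

/-- The counters change as required by `o`. -/
noncomputable def obeys [Finite K] (o : Op K) : Formula :=
  conjAll fun i : K =>
    and (whenever (i ∈ o.zero) (neg (somewhere (counts (Q := Q) i))))
    (and (whenever (o.dec ≠ some i) (neg (somewhere (ends (Q := Q) i))))
    (and (neg (somewhere (and (ends (Q := Q) i) (existsNe (ends (Q := Q) i)))))
      (whenever (o.inc = some i) (somewhere (starts (Q := Q) i)))))

noncomputable def step [Finite Q] [Finite K] (Tr : Q → Op K → Q → Prop) : Formula :=
  disjAny fun x : {x : Q × Op K × Q // Tr x.1 x.2.1 x.2.2} =>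
    and (state (K := K) x.1.1) (and (obeys (Q := Q) x.1.2.1)
      (nextTick (Q := Q) (K := K) (state (K := K) x.1.2.2)))

/-- The part of the description that does not depend on the length of waiting. -/
noncomputable def law [Finite Q] [Finite K] (Tr : Q → Op K → Q → Prop) (fin : Q) : Formula :=
  and (conjAll fun i : K => imp (counts (Q := Q) i) (neg (diaF (before (Q := Q) i))))
  (and (somewhere (tick (Q := Q) (K := K)))
  (and (imp (tick (Q := Q) (K := K)) (neg (existsNe (tick (Q := Q) (K := K)))))
  (and (imp (tick (Q := Q) (K := K)) (step Tr))
  (and (imp (tick (Q := Q) (K := K)) (conjAll fun p : {p : Q × Q // p.1 ≠ p.2} =>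
      neg (and (state (K := K) p.1.1) (state (K := K) p.1.2))))
    (somewhere (diaF (and (tick (Q := Q) (K := K)) (state (K := K) fin))))))))

/-- The current state and the next `n - 1` ones are `wait`, and then `leave` follows. -/
def waiting (K : Type) [Encodable K] (wait leave : Q) : ℕ → Formula
  | 0 => state (K := K) leave
  | n + 1 => and (state (K := K) wait) (nextTick (Q := Q) (K := K) (waiting K wait leave n))

/-- Always, everywhere `φ`. -/
def always (φ : Formula) : Formula := and (everywhere φ) (boxF (everywhere φ))

/-- The input `n` enters only through the nesting depth of `waiting`; the transition relation does
not depend on it. -/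
noncomputable def describe [Finite Q] [Finite K] (Tr : Q → Op K → Q → Prop)
    (enter wait leave fin : Q) (n : ℕ) : Formula :=
  always (and (law Tr fin) (imp (and (tick (Q := Q) (K := K)) (state (K := K) enter))
    (nextTick (Q := Q) (K := K) (waiting K wait leave n))))

/-! ### Computability of the description as a function of the waiting time. -/

theorem primrec_somewhere : Primrec somewhere :=
  primrec_neg.comp (primrec_and.comp primrec_neg (primrec_neg.comp primrec_existsNe))

theorem primrec_everywhere : Primrec everywhere :=
  primrec_neg.comp (primrec_somewhere.comp primrec_neg)

theorem primrec_always : Primrec always :=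
  primrec_and.comp primrec_everywhere
    (primrec_neg.comp (primrec_diaF.comp (primrec_neg.comp primrec_everywhere)))

theorem primrec_nextTick : Primrec (nextTick (Q := Q) (K := K)) :=
  primrec_somewhere.comp (primrec_and.comp (primrec_diaF.comp (primrec_and.comp (.const _) .id))
    (.const _))

theorem primrec_waiting (wait leave : Q) : Primrec (waiting K wait leave) := by
  have h : Primrec fun n : ℕ => (Nat.rec (state (K := K) leave)
      (fun _ φ => and (state (K := K) wait) (nextTick (Q := Q) (K := K) φ)) n : Formula) :=
    Primrec.nat_rec₁ _ (primrec_and.comp (.const _) (primrec_nextTick.comp .snd)).to₂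
  refine h.of_eq fun n => ?_
  induction n with
  | zero => rfl
  | succ n ih => simp only [waiting, ← ih]

theorem primrec_describe [Finite Q] [Finite K] (Tr : Q → Op K → Q → Prop)
    (enter wait leave fin : Q) : Primrec (describe Tr enter wait leave fin) :=
  primrec_always.comp (primrec_and.comp (.const _) (primrec_neg.comp (primrec_and.comp (.const _)
    (primrec_neg.comp (primrec_nextTick.comp (primrec_waiting _ _))))))

end Formula

/-! ### From a model to a faulty run. -/

namespace Model

open Formula

variable {V : Type v} {𝔐 : Model ℕ V}

theorem dom_mono (h𝔐 : 𝔐.IsExpanding) : Monotone 𝔐.dom := fun t t' h => by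
  rcases h.eq_or_lt with rfl | h
  · exact le_rfl
  · exact h𝔐 t t' h

theorem sat_always (h𝔐 : 𝔐.IsExpanding) {t : ℕ} {a : V} (ha : a ∈ 𝔐.dom t) {φ : Formula} :
    𝔐.Sat t a (always φ) ↔ ∀ t', t ≤ t' → ∀ b ∈ 𝔐.dom t', 𝔐.Sat t' b φ := by
  rw [always, sat_and, sat_boxF, sat_everywhere ha]
  constructor
  · rintro ⟨h1, h2⟩ t' ht'
    rcases ht'.eq_or_lt with rfl | h
    · exact h1
    · have hat := h𝔐 t t' h ha
      exact (sat_everywhere hat).1 (h2 t' h hat)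
  · exact fun h => ⟨h t le_rfl, fun t' ht' hat => (sat_everywhere hat).2 (h t' ht'.le)⟩

/-- If the promised tick came at distance two or more, its element would also be in the domain at `t
+ 1` and would satisfy there the `◇` of a tick, which `nextTick` excludes. -/
theorem sat_succ_of_sat_nextTick (h𝔐 : 𝔐.IsExpanding) {t : ℕ} {a : V} (ha : a ∈ 𝔐.dom t)
    {φ : Formula} (h : 𝔐.Sat t a (nextTick (Q := Q) (K := K) φ)) :
    ∃ b ∈ 𝔐.dom (t + 1), 𝔐.Sat (t + 1) b (tick (Q := Q) (K := K)) ∧ 𝔐.Sat (t + 1) b φ := by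
  obtain ⟨b, hb, ⟨t', htt', hbt', hs⟩, hn⟩ := (sat_somewhere ha).1 h
  rcases (Nat.succ_le_of_lt htt').eq_or_lt with rfl | hlt
  · exact ⟨b, hbt', hs⟩
  · exact absurd ⟨t + 1, t.lt_succ_self, h𝔐 _ _ t.lt_succ_self hb, t', hlt, hbt', hs.1⟩ hn

/-- The elements contributing to the counter `i` at time `t`. -/
def tokens (Q : Type) [Encodable Q] (𝔐 : Model ℕ V) (t : ℕ) (i : K) : Set V :=
  {a | 𝔐.Sat t a (counts (Q := Q) i)}

theorem tokens_subset_dom {t : ℕ} {i : K} : 𝔐.tokens Q t i ⊆ 𝔐.dom t :=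
  𝔐.interp_subset _ _

theorem mem_tokens_succ {t : ℕ} {i : K} {a : V} (h𝔐 : 𝔐.IsExpanding)
    (hlaw : ¬ 𝔐.Sat t a (diaF (before (Q := Q) i)))
    (ha : a ∈ 𝔐.tokens Q t i) (h : ¬ 𝔐.Sat t a (ends (Q := Q) i)) : a ∈ 𝔐.tokens Q (t + 1) i := by
  by_contra hn
  obtain ⟨t', htt', hat', hs⟩ : 𝔐.Sat t a (diaF (counts (Q := Q) i)) := by
    by_contra hd
    exact h ⟨ha, hd⟩
  rcases (Nat.succ_le_of_lt htt').eq_or_lt with rfl | hlt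
  · exact hn hs
  · exact hlaw ⟨t + 1, t.lt_succ_self, h𝔐 _ _ t.lt_succ_self (tokens_subset_dom ha), hn,
      t', hlt, hat', hs⟩

theorem mem_tokens_succ_of_starts {t : ℕ} {i : K} {a : V} (h𝔐 : 𝔐.IsExpanding)
    (had : a ∈ 𝔐.dom t)
    (h : 𝔐.Sat t a (starts (Q := Q) i)) : a ∈ 𝔐.tokens Q (t + 1) i := by
  by_contra hn
  obtain ⟨⟨-, t', htt', hat', hs⟩, hb⟩ := h
  rcases (Nat.succ_le_of_lt htt').eq_or_lt with rfl | hlt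
  · exact hn hs
  · exact hb ⟨t + 1, t.lt_succ_self, h𝔐 _ _ t.lt_succ_self had, hn, t', hlt, hat', hs⟩

/-- A token missing at `t + 1` must satisfy `ends` at `t`, and `obeys` allows this for at most one
token, and for none unless `i` is decremented. Additional elements may start counting unobserved, so
no equality can be expected. -/
theorem encard_tokens_le [Finite K] {t : ℕ} {a : V} {o : Op K} (h𝔐 : 𝔐.IsExpanding)
    (ha : a ∈ 𝔐.dom t)
    (hlaw : ∀ b ∈ 𝔐.dom t, ∀ i, 𝔐.Sat t b (imp (counts (Q := Q) i)
      (neg (diaF (before (Q := Q) (K := K) i)))))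
    (ho : 𝔐.Sat t a (obeys (Q := Q) o)) (i : K) :
    (𝔐.tokens Q t i).encard + one o.inc i ≤ (𝔐.tokens Q (t + 1) i).encard + one o.dec i := by
  simp only [obeys, sat_conjAll] at ho
  obtain ⟨-, h1, h2, h3⟩ := ho i
  simp only [sat_whenever, sat_neg, sat_somewhere ha] at h1 h2 h3
  let E : Set V := {b | b ∈ 𝔐.tokens Q t i ∧ 𝔐.Sat t b (ends (Q := Q) i)}
  have hE : E.encard ≤ one o.dec i := by
    unfold one
    split_ifs with h
    · refine Set.encard_le_one_iff.2 fun b b' hb hb' => ?_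
      by_contra hne
      exact h2 ⟨b, tokens_subset_dom hb.1, hb.2, b', tokens_subset_dom hb'.1,
        fun e => hne e.symm, hb'.2⟩
    · rw [nonpos_iff_eq_zero, Set.encard_eq_zero, Set.eq_empty_iff_forall_notMem]
      exact fun b hb => h1 h ⟨b, tokens_subset_dom hb.1, hb.2⟩
  have hsub : 𝔐.tokens Q t i ⊆ 𝔐.tokens Q (t + 1) i ∪ E := fun b hb => by
    by_cases h : 𝔐.Sat t b (ends (Q := Q) i)
    · exact .inr ⟨hb, h⟩
    · exact .inl (mem_tokens_succ h𝔐 (sat_imp.1 (hlaw b (tokens_subset_dom hb) i) hb) hb h)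
  refine le_trans ?_ (add_le_add_right hE _)
  refine le_trans ?_ (Set.encard_union_le _ _)
  unfold one
  split_ifs with h
  · obtain ⟨b, hb, hs⟩ := h3 h
    rw [← Set.encard_insert_of_notMem (show b ∉ 𝔐.tokens Q t i from hs.1.1)]
    exact Set.encard_le_encard
      (Set.insert_subset (.inl (mem_tokens_succ_of_starts h𝔐 hb hs)) hsub)
  · rw [add_zero]
    exact Set.encard_le_encard hsub

end Model

-- The description holds from `t₀` on, so the run is read off with time shifted by `t₀`. Since ticks
-- are unique and carry at most one state, the target state announced by one transition is the
-- source of the next.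
open Formula Model in
theorem exists_isFaultyRun [Finite Q] [Finite K] {Tr : Q → Op K → Q → Prop}
    {enter wait leave fin : Q} {n : ℕ}
    (h : ExpandingSatisfiable.{0, v} ℕ (describe Tr enter wait leave fin n)) :
    ∃ q o c, IsFaultyRun Tr q o c ∧ IsFair enter wait leave fin n q := by
  obtain ⟨V, 𝔐, h𝔐, t₀, a₀, ha₀, hs⟩ := h
  rw [describe, sat_always h𝔐 ha₀] at hs
  have hlaw := fun t ht a ha => (hs t ht a ha).1
  have hwait := fun t ht a ha => sat_imp.1 (hs t ht a ha).2
  clear hs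
  simp only [law, sat_and, sat_conjAll] at hlaw
  have htick : ∀ t, ∃ d ∈ 𝔐.dom (t₀ + t), 𝔐.Sat (t₀ + t) d (tick (Q := Q) (K := K)) := fun t => by
    have hat := dom_mono h𝔐 (Nat.le_add_right t₀ t) ha₀
    exact (sat_somewhere hat).1 (hlaw _ (Nat.le_add_right t₀ t) _ hat).2.1
  choose d hdom hd using htick
  have huniq : ∀ t, ∀ b ∈ 𝔐.dom (t₀ + t), 𝔐.Sat (t₀ + t) b (tick (Q := Q) (K := K)) →
      b = d t := fun t b hb hbt => by
    by_contra hne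
    exact sat_imp.1 (hlaw _ (Nat.le_add_right t₀ t) _ (hdom t)).2.2.1 (hd t) ⟨b, hb, hne, hbt⟩
  have hnext : ∀ t φ, 𝔐.Sat (t₀ + t) (d t) (nextTick (Q := Q) (K := K) φ) →
      𝔐.Sat (t₀ + (t + 1)) (d (t + 1)) φ := fun t φ h => by
    obtain ⟨b, hb, hbt, hφ⟩ := sat_succ_of_sat_nextTick h𝔐 (hdom t) h
    exact huniq (t + 1) b hb hbt ▸ hφ
  have hstep := fun t => sat_imp.1 (hlaw _ (Nat.le_add_right t₀ t) _ (hdom t)).2.2.2.1 (hd t)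
  simp only [step, sat_disjAny, sat_and] at hstep
  choose x hx hobeys hsucc using hstep
  have hexcl : ∀ t q, 𝔐.Sat (t₀ + t) (d t) (state (K := K) q) → q = (x t).1.1 := fun t q h => by
    by_contra hne
    have := sat_imp.1 (hlaw _ (Nat.le_add_right t₀ t) _ (hdom t)).2.2.2.2.1 (hd t)
    simp only [sat_conjAll, sat_neg, Subtype.forall] at this
    exact this (q, (x t).1.1) hne ⟨h, hx t⟩
  refine ⟨fun t => (x t).1.1, fun t => (x t).1.2.1, fun t i => (𝔐.tokens Q (t₀ + t) i).encard,
    ⟨?_, ?_, ?_⟩, ⟨?_, ?_⟩⟩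
  · intro t
    rw [← hexcl (t + 1) _ (hnext t _ (hsucc t))]
    exact (x t).2
  · intro t i hi
    rw [Set.encard_eq_zero, Set.eq_empty_iff_forall_notMem]
    have := hobeys t
    simp only [obeys, sat_conjAll] at this
    exact fun b hb => sat_whenever.1 (this i).1 hi
      ((sat_somewhere (hdom t)).2 ⟨b, tokens_subset_dom hb, hb⟩)
  · intro t i
    exact encard_tokens_le h𝔐 (hdom t)
      (fun b hb j => sat_imp.2 ((hlaw _ (Nat.le_add_right t₀ t) _ hb).1 j |> sat_imp.1))
      (hobeys t) i
  · intro t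
    obtain ⟨b, hb, t', htt', hbt', hbt, hbf⟩ :=
      (sat_somewhere (hdom t)).1 (hlaw _ (Nat.le_add_right t₀ t) _ (hdom t)).2.2.2.2.2
    obtain ⟨s, rfl⟩ := Nat.exists_eq_add_of_le ((Nat.le_add_right t₀ t).trans htt'.le)
    obtain rfl := huniq s b hbt' hbt
    exact ⟨s, by omega, (hexcl s _ hbf).symm⟩
  · intro t ht
    have key : ∀ m s, 𝔐.Sat (t₀ + s) (d s) (waiting K wait leave m) →
        (∀ j < m, (x (s + j)).1.1 = wait) ∧ (x (s + m)).1.1 = leave := by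
      intro m
      induction m with
      | zero => exact fun s h => ⟨by simp, (hexcl s _ h).symm⟩
      | succ m ih =>
        rintro s ⟨h1, h2⟩
        obtain ⟨h3, h4⟩ := ih (s + 1) (hnext s _ h2)
        refine ⟨fun j hj => ?_, by rw [← h4, add_right_comm, add_assoc]⟩
        cases j with
        | zero => exact (hexcl s _ h1).symm
        | succ j => rw [← h3 j (by omega), add_right_comm, add_assoc]
    have hent : 𝔐.Sat (t₀ + t) (d t) (state (K := K) enter) := ht ▸ hx t
    exact key n (t + 1) (hnext t _ (hwait _ (Nat.le_add_right t₀ t) _ (hdom t) ⟨hd t, hent⟩))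

end FOLTL

/-! ### The model of an exact run -/

namespace FOLTL

open CounterSystem Formula Model
open scoped Classical in
/-- In counter `i`, tokens die in the order in which they are born: the token born at time `a` is
present at time `t`. -/
def Alive {K : Type} (o : ℕ → Op K) (t a : ℕ) (i : K) : Prop :=
  (o a).inc = some i ∧ a < t ∧
    Nat.count (fun s => (o s).dec = some i) t ≤ Nat.count (fun s => (o s).inc = some i) a

variable {Q K : Type} {o : ℕ → Op K} {q : ℕ → Q}

/-- The intended meaning of the labels of the element `a` at time `t`. -/
def Label (q : ℕ → Q) (o : ℕ → Op K) (t a : ℕ) : Option (Q ⊕ K) → Prop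
  | none => a = t
  | some (.inl p) => a = t ∧ q t = p
  | some (.inr i) => Alive o t a i

/-- The constant domain model of a run. -/
def runModel [Encodable Q] [Encodable K] (q : ℕ → Q) (o : ℕ → Op K) :
    Model ℕ (ULift.{v} ℕ) where
  dom _ := Set.univ
  dom_nonempty _ := Set.univ_nonempty
  interp t n := {a | ∃ x : Option (Q ⊕ K), Encodable.encode x = n ∧ Label q o t a.down x}
  interp_subset _ _ := Set.subset_univ _

theorem Alive.antitone {s t a : ℕ} {i : K} (has : a < s) (hst : s ≤ t) (h : Alive o t a i) :
    Alive o s a i := by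
  classical
  exact ⟨h.1, has, (Nat.count_monotone _ hst).trans h.2.2⟩

theorem count_inc_eq {Tr : Q → Op K → Q → Prop} {c : ℕ → K → ℕ} [DecidableEq K]
    (h : IsExactRun Tr q o c) (t : ℕ) (i : K) :
    Nat.count (fun s => (o s).inc = some i) t =
      c t i + Nat.count (fun s => (o s).dec = some i) t := by
  induction t with
  | zero => simp [h.start]
  | succ t ih =>
    have := h.eq t i
    unfold one at this
    rw [Nat.count_succ, Nat.count_succ]
    split_ifs at this ⊢ <;> omega

/-- At value zero there have been as many decrements as increments before `t`, whereas a token born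
at `a < t` and still alive leaves fewer decrements than increments. -/
theorem not_alive_of_eq_zero {Tr : Q → Op K → Q → Prop} {c : ℕ → K → ℕ}
    (h : IsExactRun Tr q o c) {t : ℕ} {i : K} (h0 : c t i = 0) (a : ℕ) : ¬ Alive o t a i := by
  classical
  rintro ⟨h1, h2, h3⟩
  have h4 := count_inc_eq h t i
  have h5 := Nat.count_strict_mono (p := fun s => (o s).inc = some i) h1 h2
  have h6 : Nat.count (fun s => (o s).dec = some i) t ≤
    Nat.count (fun s => (o s).inc = some i) a := by convert h3
  omega

/-- A token dies at the decrement whose index equals the index of the increment that created it.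
This index determines the token, so a decrement ends at most one. -/
theorem dies_iff {t a : ℕ} {i : K} [DecidableEq K] (h : Alive o t a i) :
    ¬ Alive o (t + 1) a i ↔ (o t).dec = some i ∧
      Nat.count (fun s => (o s).inc = some i) a = Nat.count (fun s => (o s).dec = some i) t := by
  have h3 : Nat.count (fun s => (o s).dec = some i) t ≤
    Nat.count (fun s => (o s).inc = some i) a := by convert h.2.2
  have h4 : Alive o (t + 1) a i ↔ Nat.count (fun s => (o s).dec = some i) (t + 1) ≤
    Nat.count (fun s => (o s).inc = some i) a := by
    constructor
    · intro h; convert h.2.2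
    · intro h'; exact ⟨h.1, h.2.1.trans t.lt_succ_self, by convert h'⟩
  rw [h4, Nat.count_succ]
  split_ifs with h5
  · simp only [h5, true_and]; omega
  · simp only [h5, false_and, iff_false]; omega

/-- Even if the same transition decrements `i`, the new token survives: the counter was non-zero, so
an older token is ahead of it in the queue. -/
theorem alive_of_inc {Tr : Q → Op K → Q → Prop} {c : ℕ → K → ℕ}
    (h : IsExactRun Tr q o c) {t : ℕ} {i : K} (hi : (o t).inc = some i) :
    Alive o (t + 1) t i := by
  classical
  refine ⟨hi, t.lt_succ_self, ?_⟩
  have h1 := count_inc_eq h t i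
  have h2 := h.dec t i
  have h3 : Nat.count (fun s => (o s).dec = some i) (t + 1) ≤
      Nat.count (fun s => (o s).inc = some i) t := by
    rw [Nat.count_succ]
    split_ifs with h5
    · have := h2 h5; omega
    · omega
  convert h3

section

variable [Encodable Q] [Encodable K] {t : ℕ} {a : ULift.{v} ℕ}

theorem mem_interp_encode (x : Option (Q ⊕ K)) :
    a ∈ (runModel.{v} q o).interp t (Encodable.encode x) ↔ Label q o t a.down x := by
  constructor
  · rintro ⟨y, h1, h2⟩
    exact Encodable.encode_injective h1 ▸ h2
  · exact fun h => ⟨x, rfl, h⟩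

theorem sat_tick : (runModel.{v} q o).Sat t a (tick (Q := Q) (K := K)) ↔ a.down = t :=
  mem_interp_encode none

theorem sat_state {p : Q} :
    (runModel.{v} q o).Sat t a (state (K := K) p) ↔ a.down = t ∧ q t = p :=
  mem_interp_encode (some (.inl p))

theorem sat_counts {i : K} :
    (runModel.{v} q o).Sat t a (counts (Q := Q) i) ↔ Alive o t a.down i :=
  mem_interp_encode (some (.inr i))

theorem sat_somewhere_runModel {φ : Formula} : (runModel.{v} q o).Sat t a (somewhere φ) ↔
    ∃ b, (runModel.{v} q o).Sat t b φ :=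
  (sat_somewhere (Set.mem_univ _)).trans (exists_congr fun _ => and_iff_right (Set.mem_univ _))

theorem sat_nextTick {φ : Formula} (h : (runModel.{v} q o).Sat (t + 1) ⟨t + 1⟩ φ) :
    (runModel.{v} q o).Sat t a (nextTick (Q := Q) (K := K) φ) := by
  rw [nextTick, sat_somewhere (Set.mem_univ _)]
  refine ⟨⟨t + 1⟩, Set.mem_univ _, ⟨t + 1, t.lt_succ_self, Set.mem_univ _, sat_tick.2 rfl, h⟩, ?_⟩
  rintro ⟨s, hs, -, s', hs', -, h'⟩
  have : t + 1 = s' := sat_tick.1 h'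
  omega

theorem sat_before {i : K} : (runModel.{v} q o).Sat t a (before (Q := Q) i) ↔
    ¬ Alive o t a.down i ∧ ∃ s, t < s ∧ Alive o s a.down i := by
  rw [before, sat_and, sat_neg, sat_counts, sat_diaF]
  simp only [sat_counts]
  refine and_congr_right fun _ => exists_congr fun s => and_congr_right fun _ => ?_
  exact ⟨fun h => h.2, fun h => ⟨Set.mem_univ _, h⟩⟩

/-- A token alive at `s` is alive at all times after its birth up to `s`, so one that is off now and
on later is not yet born before `t`. -/
theorem le_of_sat_before {i : K} (h : (runModel.{v} q o).Sat t a (before (Q := Q) i)) :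
    t ≤ a.down := by
  obtain ⟨h1, s, hs, h2⟩ := sat_before.1 h
  by_contra hlt
  exact h1 (h2.antitone (not_le.1 hlt) hs.le)

theorem sat_ends {i : K} : (runModel.{v} q o).Sat t a (ends (Q := Q) i) →
    Alive o t a.down i ∧ ¬ Alive o (t + 1) a.down i := by
  rintro ⟨h1, h2⟩
  exact ⟨sat_counts.1 h1, fun h => h2 ⟨t + 1, t.lt_succ_self, Set.mem_univ _, sat_counts.2 h⟩⟩

theorem sat_obeys [Finite K] {Tr : Q → Op K → Q → Prop} {c : ℕ → K → ℕ}
    (h : IsExactRun Tr q o c) : (runModel.{v} q o).Sat t a (obeys (Q := Q) (o t)) := by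
  classical
  simp only [obeys, sat_conjAll, sat_and, sat_whenever, sat_neg, sat_somewhere_runModel]
  refine fun i => ⟨?_, ?_, ?_, ?_⟩
  · rintro hi ⟨b, hb⟩
    exact not_alive_of_eq_zero h (h.zero t i hi) _ (sat_counts.1 hb)
  · rintro hi ⟨b, hb⟩
    obtain ⟨h1, h2⟩ := sat_ends hb
    exact hi ((dies_iff h1).1 h2).1
  · rintro ⟨b, hb, b', -, hne, hb'⟩
    obtain ⟨h1, h2⟩ := sat_ends hb
    obtain ⟨h1', h2'⟩ := sat_ends hb'
    refine hne (ULift.down_injective (Nat.count_injective (p := fun s => (o s).inc = some i)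
      h1'.1 h1.1 ?_))
    rw [((dies_iff h1).1 h2).2, ((dies_iff h1').1 h2').2]
  · intro hi
    -- The token created by the transition at time `t` is the element numbered `t`.
    refine ⟨⟨t⟩, sat_before.2 ⟨fun h' => lt_irrefl _ h'.2.1, t + 1,
      t.lt_succ_self, alive_of_inc h hi⟩, ?_⟩
    rintro ⟨s, hs, -, hb⟩
    exact absurd (le_of_sat_before hb) (not_le.2 hs)

theorem sat_waiting {wait leave : Q} {n : ℕ} (h : ∀ j < n, q (t + j) = wait)
    (hn : q (t + n) = leave) :
    (runModel.{v} q o).Sat t ⟨t⟩ (waiting K wait leave n) := by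
  induction n generalizing t with
  | zero => exact sat_state.2 ⟨rfl, hn⟩
  | succ n ih =>
    refine ⟨sat_state.2 ⟨rfl, h 0 n.succ_pos⟩, sat_nextTick (ih (fun j hj => ?_) ?_)⟩
    · rw [← h (j + 1) (by omega), add_right_comm, add_assoc]
    · rw [← hn, add_right_comm, add_assoc]

theorem expandingSatisfiable_describe [Finite Q] [Finite K] {Tr : Q → Op K → Q → Prop}
    {enter wait leave fin : Q} {n : ℕ} {c : ℕ → K → ℕ} (h : IsExactRun Tr q o c)
    (hfair : IsFair enter wait leave fin n q) :
    ExpandingSatisfiable.{0, v} ℕ (describe Tr enter wait leave fin n) := by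
  have hexp : (runModel.{v} q o).IsExpanding := fun _ _ _ => Set.subset_univ _
  refine ⟨_, runModel.{v} q o, hexp, 0, ⟨0⟩, Set.mem_univ _, ?_⟩
  refine (sat_always hexp (Set.mem_univ _)).2 fun t _ a _ => ⟨⟨?_, ?_, ?_, ?_, ?_, ?_⟩, ?_⟩
  · rw [sat_conjAll]
    intro i
    rw [sat_imp, sat_counts]
    rintro h1 ⟨s, hs, -, hb⟩
    have := le_of_sat_before hb
    have := h1.2.1
    omega
  · exact (sat_somewhere (Set.mem_univ _)).2 ⟨⟨t⟩, Set.mem_univ _, sat_tick.2 rfl⟩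
  · rw [sat_imp, sat_tick]
    rintro h1 ⟨b, -, hb, h2⟩
    exact hb (ULift.down_injective ((sat_tick.1 h2).trans h1.symm))
  · rw [sat_imp, sat_tick, step, sat_disjAny]
    exact fun h1 => ⟨⟨(q t, o t, q (t + 1)), h.tr t⟩, sat_state.2 ⟨h1, rfl⟩, sat_obeys h,
      sat_nextTick (sat_state.2 ⟨rfl, rfl⟩)⟩
  · rw [sat_imp, sat_conjAll]
    rintro - ⟨⟨p, p'⟩, hne⟩ ⟨h1, h2⟩
    exact hne ((sat_state.1 h1).2.symm.trans (sat_state.1 h2).2)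
  · obtain ⟨s, hs, hq⟩ := hfair.recurs t
    exact (sat_somewhere (Set.mem_univ _)).2 ⟨⟨s⟩, Set.mem_univ _, s, hs, Set.mem_univ _,
      sat_tick.2 rfl, sat_state.2 ⟨rfl, hq⟩⟩
  · rw [sat_imp]
    rintro ⟨-, h2⟩
    obtain ⟨h3, h4⟩ := hfair.waits t (sat_state.1 h2).2
    exact sat_nextTick (sat_waiting h3 h4)

end

end FOLTL

/-! ### Counter machines -/

namespace CounterMachine

inductive Instr (P R : Type) where
  | inc (i : R) (next : Option P)
  | dec (i : R) (next onZero : Option P)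

variable {P R : Type}

open scoped Classical in
/-- One step of the machine with instructions `ins`. The program point `none` is the halting one. -/
noncomputable def step (ins : P → Instr P R) : Option P × (R → ℕ) → Option P × (R → ℕ)
  | (none, s) => (none, s)
  | (some p, s) =>
    match ins p with
    | .inc i x => (x, Function.update s i (s i + 1))
    | .dec i x y => if s i = 0 then (y, s) else (x, Function.update s i (s i - 1))

def Halts (ins : P → Instr P R) (σ : Option P × (R → ℕ)) : Prop :=
  ∃ T, ((step ins)^[T] σ).1 = none

theorem iterate_step_none (ins : P → Instr P R) (T : ℕ) (s : R → ℕ) :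
    (step ins)^[T] (none, s) = (none, s) :=
  Function.iterate_fixed rfl T

theorem halts_step_iff {ins : P → Instr P R} {σ : Option P × (R → ℕ)} :
    Halts ins (step ins σ) ↔ Halts ins σ := by
  constructor
  · rintro ⟨T, h⟩
    exact ⟨T + 1, h⟩
  · rintro ⟨T, h⟩
    refine ⟨T, ?_⟩
    rw [← Function.iterate_succ_apply, Function.iterate_succ_apply']
    rcases hσ : (step ins)^[T] σ with ⟨x, s⟩
    rw [hσ] at h
    obtain rfl : x = none := h
    rfl

theorem lt_of_iterate_step_eq_some {ins : P → Instr P R} {σ : Option P × (R → ℕ)} {T j : ℕ}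
    {p : P} {s : R → ℕ} (hT : ((step ins)^[T] σ).1 = none)
    (hj : (step ins)^[j] σ = (some p, s)) : j < T := by
  by_contra h
  obtain ⟨d, rfl⟩ := Nat.exists_eq_add_of_le (not_lt.1 h)
  rw [add_comm, Function.iterate_add_apply,
    show (step ins)^[T] σ = (none, ((step ins)^[T] σ).2) from Prod.ext hT rfl,
    iterate_step_none] at hj
  cases hj

end CounterMachine

/-! ### Running a counter machine backwards -/

namespace Backward

open CounterSystem CounterMachine

inductive State (P : Type) where
  | done | copy | copyAux | restore | spread | enter | load | loaded
  | sim (p : P)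

/-- The places of the tokens whose number is bounded during a phase: the free ones, the used ones,
the input, and the registers of the machine. -/
inductive Place (R : Type) where
  | free | used | input
  | reg (i : R)

/-- `goal` is a lower bound for the number of tokens with which the coming phase starts; `goalAux`
keeps its value while it is being copied. -/
inductive Counter (R : Type) where
  | goal | goalAux
  | work (w : Place R)

variable {P R : Type}

instance [Finite P] : Finite (State P) :=
  Finite.of_injective (β := Option P × Fin 8) (fun
    | .done => (none, 0) | .copy => (none, 1) | .copyAux => (none, 2) | .restore => (none, 3)
    | .spread => (none, 4) | .enter => (none, 5) | .load => (none, 6) | .loaded => (none, 7)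
    | .sim p => (some p, 0)) (by
    intro x y h
    cases x <;> cases y <;> simp_all)

instance [Finite R] : Finite (Place R) :=
  Finite.of_injective (β := Option R × Fin 3) (fun
    | .free => (none, 0) | .used => (none, 1) | .input => (none, 2)
    | .reg i => (some i, 0)) (by
    intro x y h
    cases x <;> cases y <;> simp_all)

instance [Finite R] : Finite (Counter R) :=
  Finite.of_injective (β := Option (Place R) × Fin 2) (fun
    | .goal => (none, 0) | .goalAux => (none, 1)
    | .work w => (some w, 0)) (by
    intro x y h
    cases x <;> cases y <;> simp_all)

open State Counter Place

/-- A phase starts by adding as many free tokens as the current goal, and then raises the goal. It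
continues with backward simulations of the machine from an arbitrary configuration without free
tokens to the initial one. A simulation conserves the number of tokens, and one token is removed
after it. -/
inductive Tr (ins : P → Instr P R) (p₀ : P) (r₀ : R) :
    State P → Op (Counter R) → State P → Prop
  | begin : Tr ins p₀ r₀ done ⟨∅, none, none⟩ copy
  | copy : Tr ins p₀ r₀ copy ⟨∅, some goal, some goalAux⟩ copyAux
  | copyAux : Tr ins p₀ r₀ copyAux ⟨∅, none, some (work free)⟩ copy
  | copied : Tr ins p₀ r₀ copy ⟨{goal}, none, none⟩ restore
  -- These tokens make up for an empty input place: the first phase starts without the `n` tokens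
  -- that later phases inherit.
  | extra : Tr ins p₀ r₀ restore ⟨∅, none, some (work free)⟩ restore
  | restore : Tr ins p₀ r₀ restore ⟨∅, some goalAux, some goal⟩ restore
  | restored : Tr ins p₀ r₀ restore ⟨{goalAux}, none, some goal⟩ spread
  | spreadInput : Tr ins p₀ r₀ spread ⟨∅, some (work input), some (work free)⟩ spread
  | spreadUsed : Tr ins p₀ r₀ spread ⟨∅, some (work free), some (work used)⟩ spread
  | spreadReg (i : R) : Tr ins p₀ r₀ spread ⟨∅, some (work free), some (work (reg i))⟩ spread
  | sim (p : P) : Tr ins p₀ r₀ spread ⟨{work free, work input}, none, none⟩ (sim p)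
  -- Time runs against the machine. In the machine's direction, an increment moves a token from free
  -- to the register, a decrement from the register to used, and a successful zero test from free to
  -- used.
  | inc {p p' : P} {i : R} (h : ins p = .inc i (some p')) :
      Tr ins p₀ r₀ (sim p') ⟨∅, some (work (reg i)), some (work free)⟩ (sim p)
  | dec {p p' : P} {i : R} {y : Option P} (h : ins p = .dec i (some p') y) :
      Tr ins p₀ r₀ (sim p') ⟨∅, some (work used), some (work (reg i))⟩ (sim p)
  | zero {p p' : P} {i : R} {x : Option P} (h : ins p = .dec i x (some p')) :
      Tr ins p₀ r₀ (sim p') ⟨{work (reg i)}, some (work used), some (work free)⟩ (sim p)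
  | enter : Tr ins p₀ r₀ (sim p₀) ⟨{work input}, none, none⟩ enter
  | enterLoad : Tr ins p₀ r₀ enter ⟨∅, none, none⟩ load
  | enterLoaded : Tr ins p₀ r₀ enter ⟨∅, none, none⟩ loaded
  | load : Tr ins p₀ r₀ load ⟨∅, some (work (reg r₀)), some (work input)⟩ load
  | loadLoaded : Tr ins p₀ r₀ load ⟨∅, some (work (reg r₀)), some (work input)⟩ loaded
  | again : Tr ins p₀ r₀ loaded
      ⟨{x | x = work used ∨ ∃ i, x = work (reg i)}, some (work free), none⟩ spread
  | done : Tr ins p₀ r₀ loaded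
      ⟨{x | x = work free ∨ x = work used ∨ ∃ i, x = work (reg i)}, none, none⟩ done

/-- A transition in which counters may spontaneously increase. -/
structure IsFaultyStep (ins : P → Instr P R) (p₀ : P) (r₀ : R) (x : State P)
    (o : Op (Counter R)) (c : Counter R → ℕ) (y : State P) (c' : Counter R → ℕ) : Prop where
  tr : Tr ins p₀ r₀ x o y
  zero : ∀ i ∈ o.zero, c i = 0
  le : ∀ i, c i + one o.inc i ≤ c' i + one o.dec i

/-! ### Counters of a fair faulty run are finite. -/

section Finiteness

variable {ins : P → Instr P R} {p₀ : P} {r₀ : R} {q : ℕ → State P} {o : ℕ → Op (Counter R)}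
  {c : ℕ → Counter R → ℕ∞} {n : ℕ}

theorem exists_exit {A : Set (State P)} {t : ℕ}
    (hfair : IsFair enter load loaded done n q) (ht : q t ∈ A) (hA : done ∉ A) :
    ∃ s, t ≤ s ∧ q s ∈ A ∧ q (s + 1) ∉ A := by
  by_contra! h
  have key : ∀ d, q (t + d) ∈ A := fun d => by
    induction d with
    | zero => exact ht
    | succ d ih => exact h _ (Nat.le_add_right t d) ih
  obtain ⟨s, hs, hq⟩ := hfair.recurs t
  obtain ⟨d, rfl⟩ := Nat.exists_eq_add_of_le hs.le
  exact hA (hq ▸ key d)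

theorem exists_copy (h : IsFaultyRun (Tr ins p₀ r₀) q o c)
    (hfair : IsFair enter load loaded done n q) (t : ℕ) : ∃ s, t ≤ s ∧ q s = copy := by
  obtain ⟨s, hs, hq⟩ := hfair.recurs t
  refine ⟨s + 1, by omega, ?_⟩
  have := h.tr s
  rw [hq] at this
  generalize q (s + 1) = x, o s = y at this ⊢
  cases this
  rfl

/-- For each counter there is a set of states containing `copy` but not `done` every exit from which
tests that counter, and recurrence of `done` forces such an exit. -/
theorem exists_eq_zero (h : IsFaultyRun (Tr ins p₀ r₀) q o c)
    (hfair : IsFair enter load loaded done n q) (i : Counter R) (t : ℕ) :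
    ∃ s, t ≤ s ∧ c s i = 0 := by
  obtain ⟨t₁, ht₁, hq⟩ := exists_copy h hfair t
  have key : ∀ A : Set (State P), copy ∈ A → done ∉ A →
      (∀ x o y, Tr ins p₀ r₀ x o y → x ∈ A → y ∉ A → i ∈ o.zero) → ∃ s, t ≤ s ∧ c s i = 0 := by
    intro A h1 h2 h3
    obtain ⟨s, hs, hs1, hs2⟩ := exists_exit hfair (hq ▸ h1 : q t₁ ∈ A) h2
    exact ⟨s, ht₁.trans hs, h.zero s i (h3 _ _ _ (h.tr s) hs1 hs2)⟩
  match i with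
  | goal =>
    refine key {copy, copyAux} (by simp) (by simp) fun x o y hx h1 h2 => ?_
    cases hx <;> first | (simp at h2; done) | (simp at h1; done) | simp
  | goalAux =>
    refine key {copy, copyAux, restore} (by simp) (by simp) fun x o y hx h1 h2 => ?_
    cases hx <;> first | (simp at h2; done) | (simp at h1; done) | simp
  | work input =>
    refine key {copy, copyAux, restore, spread} (by simp) (by simp) fun x o y hx h1 h2 => ?_
    cases hx <;> first | (simp at h2; done) | (simp at h1; done) | simp
  | work free =>
    refine key {done}ᶜ (by simp) (by simp) fun x o y hx h1 h2 => ?_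
    cases hx <;> first | (simp at h2; done) | (simp at h1; done) | simp
  | work used =>
    refine key {done}ᶜ (by simp) (by simp) fun x o y hx h1 h2 => ?_
    cases hx <;> first | (simp at h2; done) | (simp at h1; done) | simp
  | work (reg j) =>
    refine key {done}ᶜ (by simp) (by simp) fun x o y hx h1 h2 => ?_
    cases hx <;> first | (simp at h2; done) | (simp at h1; done) | simp

/-- An infinite counter loses at most one token per step, so it would stay infinite, against its
next zero test. -/
theorem exists_isFaultyStep (h : IsFaultyRun (Tr ins p₀ r₀) q o c)
    (hfair : IsFair enter load loaded done n q) :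
    ∃ c' : ℕ → Counter R → ℕ, ∀ t,
      IsFaultyStep ins p₀ r₀ (q t) (o t) (c' t) (q (t + 1)) (c' (t + 1)) := by
  have hone : ∀ (x : Option (Counter R)) i, (one x i : ℕ∞) = ((one x i : ℕ) : ℕ∞) := fun x i => by
    unfold one
    split_ifs <;> simp
  have hpred : ∀ t i, c (t + 1) i ≠ ⊤ → c t i ≠ ⊤ := fun t i h1 h2 => by
    have := h.le t i
    rw [h2, top_add, top_le_iff, hone] at this
    exact WithTop.add_ne_top.2 ⟨h1, ENat.natCast_ne_top _⟩ this
  have hfin : ∀ t i, c t i ≠ ⊤ := fun t i => by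
    obtain ⟨s, hs, h0⟩ := exists_eq_zero h hfair i t
    obtain ⟨d, rfl⟩ := Nat.exists_eq_add_of_le hs
    have : c (t + d) i ≠ ⊤ := by simp [h0]
    clear h0 hs
    induction d with
    | zero => exact this
    | succ d ih => exact ih (hpred _ _ this)
  choose c' hc' using fun t i => ENat.ne_top_iff_exists.1 (hfin t i)
  refine ⟨c', fun t => ⟨h.tr t, fun i hi => ?_, fun i => ?_⟩⟩
  · have := h.zero t i hi
    rw [← hc'] at this
    exact_mod_cast this
  · have := h.le t i
    rw [← hc', ← hc', hone, hone] at this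
    exact_mod_cast this

end Finiteness

end Backward

namespace Backward

open CounterSystem CounterMachine State Counter Place

variable {P R : Type} {ins : P → Instr P R} {p₀ : P} {r₀ : R} {x y : State P}
  {o : Op (Counter R)} {c c' : Counter R → ℕ} {n : ℕ}

/-! ### The goal grows -/

/-- Here `g` bounds the goal at the start of the phase from below. Each token taken from `goal` must
reappear both in `goalAux` and as a free token; the additional `1` at `copyAux` is the free token
still owed. All conditions are lower bounds, so errors cannot destroy them. -/
def GoalInv (g : ℕ) (x : State P) (c : Counter R → ℕ) : Prop :=
  match x with
  | done => g ≤ c goal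
  | copy => g ≤ c goal + c goalAux ∧ g ≤ c goal + c (work free)
  | copyAux => g ≤ c goal + c goalAux ∧ g ≤ c goal + c (work free) + 1
  | restore => g ≤ c goal + c goalAux ∧ g ≤ c (work free)
  | _ => g + 1 ≤ c goal

theorem GoalInv.step {g : ℕ} (hg : GoalInv g x c) (h : IsFaultyStep ins p₀ r₀ x o c y c') :
    (y ≠ done → GoalInv g y c') ∧ (y = done → GoalInv (g + 1) y c') := by
  obtain ⟨htr, hz, hle⟩ := h
  have h1 := hle goal
  have h2 := hle goalAux
  have h3 := hle (work free)
  cases htr <;> simp [GoalInv, one] at hg hz h1 h2 h3 ⊢ <;> omega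

/-! ### The number of tokens is bounded -/

section

variable [Fintype (Place R)]

def total (c : Counter R → ℕ) : ℕ := ∑ w, c (work w)

theorem sum_one_none : ∑ w : Place R, (one none (work w) : ℕ) = 0 := by simp [one]

theorem sum_one_work (v : Place R) : ∑ w : Place R, (one (some (work v)) (work w) : ℕ) = 1 := by
  classical
  have : ∀ w, (one (some (work v)) (work w) : ℕ) = if v = w then 1 else 0 := fun w => by
    unfold one
    congr 1
    simp
  simp [this]

theorem total_add_le (hle : ∀ i, c i + one o.inc i ≤ c' i + one o.dec i) :
    total c + ∑ w, one o.inc (work w) ≤ total c' + ∑ w, one o.dec (work w) := by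
  simp only [total, ← Finset.sum_add_distrib]
  exact Finset.sum_le_sum fun w _ => hle (work w)

/-- Errors only add tokens and cannot cancel, so a balanced total means that no place suffered an
error. -/
theorem add_one_eq_of_total_eq (hle : ∀ i, c i + one o.inc i ≤ c' i + one o.dec i)
    (h : total c + ∑ w, one o.inc (work w) = total c' + ∑ w, one o.dec (work w)) (w : Place R) :
    c (work w) + one o.inc (work w) = c' (work w) + one o.dec (work w) := by
  simp only [total, ← Finset.sum_add_distrib] at h
  exact (Finset.sum_eq_sum_iff_of_le fun w _ => hle (work w)).1 h w (Finset.mem_univ w)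

theorem total_eq_of_forall_eq_zero {v w : Place R} (hvw : v ≠ w)
    (h : ∀ u, u ≠ v → u ≠ w → c (work u) = 0) : total c = c (work v) + c (work w) :=
  Fintype.sum_eq_add v w hvw fun u hu => h u hu.1 hu.2

/-- The bound for the numbers of tokens, provided that the machine halts; here `σ` is its initial
configuration. -/
def Bounded (ins : P → Instr P R) (σ : Option P × (R → ℕ)) (n B : ℕ) (x : State P)
    (c : Counter R → ℕ) : Prop :=
  match x with
  | loaded => (c (work used) = 0 ∧ ∀ i, c (work (reg i)) = 0) ∧
      (c (work free) + c (work input) ≤ B ∨ c (work free) = 0)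
  | spread => total c < B
  | sim p => ∃ N ≤ B, total c ≤ N ∧ (total c = N → ∃ j,
      (step ins)^[j] σ = (some p, fun i => c (work (reg i))) ∧ N ≤ c (work free) + j + n)
  | _ => True

/-- The bound travels backwards in time, that is, forwards along the machine. Errors can only push
the earlier total below `N`, and then nothing more is required. If the total still equals `N`, there
was no error and the transition undoes a genuine machine step: `j` grows by one and the free tokens
drop by at most one, which preserves `N ≤ free + j + n`. -/
theorem Bounded.of_step {σ : Option P × (R → ℕ)} {T : ℕ} (hT : ((step ins)^[T] σ).1 = none)
    (hy : Bounded ins σ n (T + n) y c') (h : IsFaultyStep ins p₀ r₀ x o c y c')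
    (hne : y ≠ enter) : Bounded ins σ n (T + n) x c := by
  classical
  obtain ⟨htr, hz, hle⟩ := h
  have htot := total_add_le hle
  have heq := add_one_eq_of_total_eq hle
  cases htr with
  | spreadInput | spreadUsed | spreadReg =>
    simp only [sum_one_work] at htot
    simp only [Bounded] at hy ⊢
    omega
  | sim p =>
    simp only [sum_one_none, add_zero] at htot heq
    obtain ⟨N, hN, hN1, hN2⟩ := hy
    have h0 : c (work free) = 0 := hz _ (by simp)
    show total c < T + n
    by_contra hlt
    obtain ⟨j, hj, hj1⟩ := hN2 (by omega)
    have h1 := heq (by omega) free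
    -- The configuration after `j` steps is not halted, so `j < T`. No free token remains, whence `N
    -- ≤ j + n < T + n`.
    have := lt_of_iterate_step_eq_some hT hj
    simp only [one, reduceCtorEq, if_false] at h1
    omega
  | @inc p p' i hp =>
    simp only [sum_one_work] at htot heq
    obtain ⟨N, hN, hN1, hN2⟩ := hy
    refine ⟨N, hN, by omega, fun he => ?_⟩
    obtain ⟨j, hj, hj1⟩ := hN2 (by omega)
    have heq' := heq (by omega)
    have hf := heq' free
    simp [one] at hf
    refine ⟨j + 1, ?_, by omega⟩
    rw [Function.iterate_succ_apply', hj]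
    simp only [step, hp, Prod.mk.injEq, true_and]
    funext k
    have hk := heq' (reg k)
    by_cases hik : i = k
    · subst hik
      simp [one] at hk
      simp [hk]
    · simp [one, hik] at hk
      simp [Function.update_of_ne (Ne.symm hik), hk]
  | @dec p p' i _ hp =>
    simp only [sum_one_work] at htot heq
    obtain ⟨N, hN, hN1, hN2⟩ := hy
    refine ⟨N, hN, by omega, fun he => ?_⟩
    obtain ⟨j, hj, hj1⟩ := hN2 (by omega)
    have heq' := heq (by omega)
    have hf := heq' free
    have hi := heq' (reg i)
    simp [one] at hf hi
    refine ⟨j + 1, ?_, by omega⟩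
    rw [Function.iterate_succ_apply', hj]
    simp only [step, hp]
    rw [if_neg (by omega)]
    simp only [Prod.mk.injEq, true_and]
    funext k
    have hk := heq' (reg k)
    by_cases hik : i = k
    · subst hik
      simp [← hi]
    · simp [one, hik] at hk
      simp [Function.update_of_ne (Ne.symm hik), hk]
  | @zero p p' i _ hp =>
    simp only [sum_one_work] at htot heq
    obtain ⟨N, hN, hN1, hN2⟩ := hy
    refine ⟨N, hN, by omega, fun he => ?_⟩
    obtain ⟨j, hj, hj1⟩ := hN2 (by omega)
    have heq' := heq (by omega)
    have hf := heq' free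
    have hi := heq' (reg i)
    have h0 : c (work (reg i)) = 0 := hz _ rfl
    simp [one] at hf hi
    refine ⟨j + 1, ?_, by omega⟩
    rw [Function.iterate_succ_apply', hj]
    simp only [step, hp]
    rw [if_pos (by omega)]
    simp only [Prod.mk.injEq, true_and]
    funext k
    have hk := heq' (reg k)
    simp [one] at hk
    exact hk.symm
  | enter => exact absurd rfl hne
  | again =>
    simp only [sum_one_work, sum_one_none] at htot
    have hu : c (work used) = 0 := hz _ (.inl rfl)
    have hr : ∀ i, c (work (reg i)) = 0 := fun i => hz _ (.inr ⟨i, rfl⟩)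
    refine ⟨⟨hu, hr⟩, .inl ?_⟩
    rw [← total_eq_of_forall_eq_zero (c := c) (by simp)]
    · simp only [Bounded] at hy
      omega
    · rintro (_ | _ | _ | i) h1 h2 <;> simp_all
  | done =>
    exact ⟨⟨hz _ (.inr (.inl rfl)), fun i => hz _ (.inr (.inr ⟨i, rfl⟩))⟩, .inr (hz _ (.inl rfl))⟩
  | _ => trivial

end

/-! ### The bound along a whole run. -/

section

variable {q : ℕ → State P} {o : ℕ → Op (Counter R)} {c : ℕ → Counter R → ℕ}

theorem counters_of_load (h : ∀ t, IsFaultyStep ins p₀ r₀ (q t) (o t) (c t) (q (t + 1)) (c (t + 1)))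
    (j t : ℕ) (hq : ∀ i < j, q (t + i) = load) :
    c t (work free) ≤ c (t + j) (work free) ∧ c t (work used) ≤ c (t + j) (work used) ∧
      c t (work input) + j ≤ c (t + j) (work input) ∧
      c t (work (reg r₀)) ≤ c (t + j) (work (reg r₀)) + j ∧
      ∀ i, i ≠ r₀ → c t (work (reg i)) ≤ c (t + j) (work (reg i)) := by
  induction j generalizing t with
  | zero => simp
  | succ j ih =>
    obtain ⟨h1, h2, h3, h4, h5⟩ := ih (t + 1) fun i hi => by
      rw [← hq (i + 1) (by omega), add_right_comm, add_assoc]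
    rw [add_right_comm, add_assoc] at h1 h2 h3 h4 h5
    obtain ⟨htr, -, hle⟩ := h t
    have hop : o t = ⟨∅, some (work (reg r₀)), some (work input)⟩ := by
      rw [show q t = load from hq 0 j.succ_pos] at htr
      generalize q (t + 1) = y, o t = z at htr
      cases htr <;> rfl
    rw [hop] at hle
    have e1 := hle (work free)
    have e2 := hle (work used)
    have e3 := hle (work input)
    have e4 := hle (work (reg r₀))
    simp [one] at e1 e2 e3 e4
    refine ⟨by omega, by omega, by omega, by omega, fun i hi => ?_⟩
    have e5 := hle (work (reg i))
    simp [one, hi.symm] at e5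
    exact e5.trans (h5 i hi)

/-- Here `N` is the number of free tokens at `loaded` plus `n`. The `n` loads remove at most `n`
tokens from `r₀`, which ends empty, so the total before them is at most `N`, with equality only in
the initial configuration (`j = 0`). They also put at least `n` tokens into the input place, so
either alternative at `loaded` gives `N ≤ T + n`. -/
theorem Bounded.of_enter [Fintype (Place R)] [DecidableEq R] {T t : ℕ} {p : P}
    (h : ∀ t, IsFaultyStep ins p₀ r₀ (q t) (o t) (c t) (q (t + 1)) (c (t + 1)))
    (hfair : IsFair enter load loaded done n q) (ht : q t = sim p) (ht' : q (t + 1) = enter)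
    (hb : Bounded ins (some p₀, Function.update 0 r₀ n) n (T + n) (q (t + 1 + 1 + n))
      (c (t + 1 + 1 + n))) :
    Bounded ins (some p₀, Function.update 0 r₀ n) n (T + n) (q t) (c t) := by
  obtain ⟨hw1, hw2⟩ := hfair.waits _ ht'
  rw [hw2] at hb
  obtain ⟨⟨b1, b2⟩, b3⟩ := hb
  obtain ⟨h1, h2, h3, h4, h5⟩ := counters_of_load h n (t + 1 + 1) hw1
  have hle1 : ∀ i, c (t + 1) i ≤ c (t + 1 + 1) i := by
    obtain ⟨htr, -, hle⟩ := h (t + 1)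
    rw [ht'] at htr
    generalize q (t + 1 + 1) = y, o (t + 1) = z at htr hle
    cases htr <;> simpa [one] using hle
  obtain ⟨htr, hz, hle⟩ := h t
  rw [ht, ht'] at htr
  rw [ht]
  generalize o t = z at htr hz hle
  cases htr
  have hle2 : ∀ i, c t i ≤ c (t + 1 + 1) i := fun i => by
    have := hle i
    simp [one] at this
    exact this.trans (hle1 i)
  have h0 : c t (work input) = 0 := hz _ rfl
  have htot : total (c t) = c t (work free) + c t (work (reg r₀)) := by
    refine total_eq_of_forall_eq_zero (by simp) ?_
    rintro (_ | _ | _ | i) e1 e2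
    · exact absurd rfl e1
    · have := hle2 (work used)
      omega
    · exact h0
    · have := hle2 (work (reg i))
      have := h5 i (fun e => e2 (by rw [e]))
      have := b2 i
      omega
  have e1 := hle2 (work free)
  have e2 := hle2 (work (reg r₀))
  have e3 := b2 r₀
  refine ⟨c (t + 1 + 1 + n) (work free) + n, by omega, by omega, fun he => ⟨0, ?_, by omega⟩⟩
  simp only [Function.iterate_zero, id, Prod.mk.injEq, true_and]
  funext i
  by_cases hi : i = r₀
  · subst hi
    simp only [Function.update_self]
    omega
  · have := hle2 (work (reg i))
    have := h5 i hi
    have := b2 i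
    simp only [Function.update_of_ne hi, Pi.zero_apply]
    omega

/-- Induction backwards from the next visit to `done`. Inside the loading segment `Bounded` carries
no information, so that segment is crossed in one jump from `loaded` to the state before `enter`. -/
theorem bounded [Fintype (Place R)] [DecidableEq R] {T : ℕ}
    (h : ∀ t, IsFaultyStep ins p₀ r₀ (q t) (o t) (c t) (q (t + 1)) (c (t + 1)))
    (hfair : IsFair enter load loaded done n q)
    (hT : ((step ins)^[T] (some p₀, Function.update 0 r₀ n)).1 = none) (t : ℕ) :
    Bounded ins (some p₀, Function.update 0 r₀ n) n (T + n) (q t) (c t) := by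
  obtain ⟨s, hts, hs⟩ := hfair.recurs t
  obtain ⟨d, rfl⟩ := Nat.exists_eq_add_of_le hts.le
  clear hts
  induction d using Nat.strong_induction_on generalizing t with
  | _ d ih =>
  cases d with
  | zero =>
    rw [show q t = done from hs]
    trivial
  | succ d =>
    have ih' : ∀ e, e < d + 1 → Bounded ins (some p₀, Function.update 0 r₀ n) n (T + n)
        (q (t + 1 + e)) (c (t + 1 + e)) := fun e he => by
      refine ih (d - e) (by omega) (t + 1 + e) ?_
      rw [← hs]
      congr 1
      omega
    by_cases he : q (t + 1) = enter
    · have hp : ∃ p, q t = sim p := by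
        have htr := (h t).tr
        rw [he] at htr
        generalize q t = y, o t = z at htr
        cases htr
        exact ⟨_, rfl⟩
      obtain ⟨p, hp⟩ := hp
      obtain ⟨hw1, hw2⟩ := hfair.waits _ he
      refine Bounded.of_enter h hfair hp he ?_
      rw [add_assoc (t + 1)]
      refine ih' (1 + n) ?_
      -- The visit to `done` cannot fall inside the loading segment, so the induction hypothesis
      -- reaches its end.
      by_contra hlt
      rcases d with _ | d
      · rw [zero_add] at hs
        rw [hs] at he
        cases he
      · have := hw1 d (by omega)
        rw [show t + 1 + 1 + d = t + (d + 1 + 1) by omega, hs] at this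
        cases this
    · exact Bounded.of_step hT (ih' 0 d.succ_pos) (h t) he

/-- If the machine halts, then the phases cannot go on forever. -/
theorem not_halts_of_isFair [Finite R] [DecidableEq R]
    (h : ∀ t, IsFaultyStep ins p₀ r₀ (q t) (o t) (c t) (q (t + 1)) (c (t + 1)))
    (hfair : IsFair enter load loaded done n q) :
    ¬ Halts ins (some p₀, Function.update 0 r₀ n) := by
  classical
  rintro ⟨T, hT⟩
  cases nonempty_fintype (Place R)
  have hb := bounded h hfair hT
  have hgrow : ∀ g, ∃ t, q t = done ∧ GoalInv g (q t) (c t) := fun g => by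
    induction g with
    | zero =>
      obtain ⟨t, -, ht⟩ := hfair.recurs 0
      exact ⟨t, ht, by rw [ht]; exact Nat.zero_le _⟩
    | succ g ih =>
      obtain ⟨t, ht, hg⟩ := ih
      have hex : ∃ d, q (t + (d + 1)) = done := by
        obtain ⟨s, hs, hq⟩ := hfair.recurs t
        obtain ⟨d, rfl⟩ := Nat.exists_eq_add_of_lt hs
        exact ⟨d, hq⟩
      have key : ∀ d ≤ Nat.find hex, GoalInv g (q (t + d)) (c (t + d)) := fun d => by
        induction d with
        | zero => exact fun _ => hg
        | succ d ih =>
          exact fun hd => ((ih (by omega)).step (h (t + d))).1 (Nat.find_min hex (by omega))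
      exact ⟨_, Nat.find_spec hex, ((key _ le_rfl).step (h _)).2 (Nat.find_spec hex)⟩
  -- From a goal this large, entering `spread` would need at least `T + n` free tokens, against the
  -- bound there. So the run stays in the copying states and never returns to `done`.
  obtain ⟨t, ht, hg⟩ := hgrow (T + n)
  have key : ∀ d, GoalInv (T + n) (q (t + d)) (c (t + d)) ∧
      (q (t + (d + 1)) = copy ∨ q (t + (d + 1)) = copyAux ∨ q (t + (d + 1)) = restore) := by
    have hstep : ∀ {x y : State P} {o : Op (Counter R)} {c c' : Counter R → ℕ},
        IsFaultyStep ins p₀ r₀ x o c y c' → GoalInv (T + n) x c →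
        Bounded ins (some p₀, Function.update 0 r₀ n) n (T + n) y c' →
        (x = done ∨ x = copy ∨ x = copyAux ∨ x = restore) →
        y = copy ∨ y = copyAux ∨ y = restore := by
      rintro x y o c c' ⟨htr, hz, hle⟩ hg hb hx
      cases htr
      case restored =>
        have h1 := hle (work free)
        have h2 : c' (work free) ≤ total c' :=
          Finset.single_le_sum (f := fun w => c' (work w)) (fun _ _ => Nat.zero_le _)
            (Finset.mem_univ free)
        simp [GoalInv, Bounded, one] at hg hb h1
        omega
      all_goals simp at hx ⊢
    intro d
    induction d with
    | zero => exact ⟨hg, hstep (h t) hg (hb _) (.inl ht)⟩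
    | succ d ih =>
      have hg' := (ih.1.step (h (t + d))).1 (by rcases ih.2 with e | e | e <;>
        rw [show q (t + d + 1) = _ from e] <;> simp)
      exact ⟨hg', hstep (h (t + (d + 1))) hg' (hb _) (.inr ih.2)⟩
  obtain ⟨s, hs, hq⟩ := hfair.recurs t
  obtain ⟨d, rfl⟩ := Nat.exists_eq_add_of_lt hs
  have := (key d).2
  rw [show t + (d + 1) = t + d + 1 from rfl, hq] at this
  simp at this

end

end Backward

/-! ### Concatenating paths -/

section Paths

variable {α : Type*} {r : α → α → Prop}

/-- There is a path with `n + 1` steps. -/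
def IsPath (r : α → α → Prop) : ℕ → α → α → Prop
  | 0, x, y => r x y
  | n + 1, x, y => ∃ z, r x z ∧ IsPath r n z y

theorem exists_isPath {x y : α} (h : Relation.TransGen r x y) : ∃ n, IsPath r n x y := by
  induction h using Relation.TransGen.head_induction_on with
  | single h => exact ⟨0, h⟩
  | head h _ ih =>
    obtain ⟨n, hn⟩ := ih
    exact ⟨n + 1, _, h, hn⟩

theorem exists_infinite_path {σ : ℕ → α} (h : ∀ g, Relation.TransGen r (σ g) (σ (g + 1))) :
    ∃ f : ℕ → α, f 0 = σ 0 ∧ (∀ t, r (f t) (f (t + 1))) ∧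
      ∀ t, ∃ t', t < t' ∧ ∃ g, f t' = σ g := by
  choose len hlen using fun g => exists_isPath (h g)
  -- A state of the walk: the current point, the index of the target, and the number of steps left
  -- after the next one.
  let S := {s : α × ℕ × ℕ // IsPath r s.2.2 s.1 (σ s.2.1)}
  have hnext : ∀ s : S, ∃ s' : S, r s.1.1 s'.1.1 ∧
      (s.1.2.2 = 0 → s'.1.1 = σ s.1.2.1) ∧ ∀ m, s.1.2.2 = m + 1 → s'.1.2.2 = m := by
    rintro ⟨⟨x, g, _ | m⟩, hs⟩
    · exact ⟨⟨(σ g, g + 1, len g), hlen g⟩, hs, fun _ => rfl, by simp⟩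
    · obtain ⟨z, hz, hp⟩ := hs
      exact ⟨⟨(z, g, m), hp⟩, hz, by simp, by simp⟩
  choose next h1 h2 h3 using hnext
  let F : ℕ → S := fun t => next^[t] ⟨(σ 0, 1, len 0), hlen 0⟩
  have hF : ∀ t, F (t + 1) = next (F t) := fun t => Function.iterate_succ_apply' _ _ _
  have hit : ∀ m t, (F t).1.2.2 = m → ∃ t', t < t' ∧ ∃ g, (F t').1.1 = σ g := by
    intro m
    induction m with
    | zero => exact fun t ht => ⟨t + 1, t.lt_succ_self, _, by rw [hF]; exact h2 _ ht⟩
    | succ m ih =>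
      intro t ht
      obtain ⟨t', ht', hg⟩ := ih (t + 1) (by rw [hF]; exact h3 _ _ ht)
      exact ⟨t', by omega, hg⟩
  exact ⟨fun t => (F t).1.1, rfl, fun t => by simp only [hF]; exact h1 _, fun t => hit _ t rfl⟩

end Paths

/-! ### The exact run when the machine does not halt. -/

namespace Backward

open CounterSystem CounterMachine State Counter Place Relation

variable {P R : Type} {ins : P → Instr P R} {p₀ : P} {r₀ : R} {n : ℕ}

/-- A step without errors. Configurations are equipped with the number of remaining `load`s. -/
structure IsExactStep (ins : P → Instr P R) (p₀ : P) (r₀ : R) (n : ℕ)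
    (x y : State P × ℕ × (Counter R → ℕ)) (o : Op (Counter R)) : Prop where
  tr : Tr ins p₀ r₀ x.1 o y.1
  zero : ∀ i ∈ o.zero, x.2.2 i = 0
  dec : ∀ i, o.dec = some i → x.2.2 i ≠ 0
  eq : ∀ i, y.2.2 i + one o.dec i = x.2.2 i + one o.inc i
  enter : x.1 = enter → y.2.1 = n
  load : x.1 = load → x.2.1 = y.2.1 + 1
  stay : x.1 = .enter ∨ x.1 = .load → y.1 = if y.2.1 = 0 then .loaded else .load

def Leads (ins : P → Instr P R) (p₀ : P) (r₀ : R) (n : ℕ)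
    (x y : State P × ℕ × (Counter R → ℕ)) : Prop :=
  ∃ o, IsExactStep ins p₀ r₀ n x y o

/-- The counters with the given values. -/
def counters (f u i : ℕ) (s : R → ℕ) (g g' : ℕ) : Counter R → ℕ
  | goal => g
  | goalAux => g'
  | work free => f
  | work used => u
  | work input => i
  | work (reg k) => s k

theorem Leads.of_tr {x y : State P} {c c' : Counter R → ℕ} {o : Op (Counter R)}
    (h : Tr ins p₀ r₀ x o y) (hx : x ≠ enter) (hx' : x ≠ load) (hz : ∀ i ∈ o.zero, c i = 0)
    (hd : ∀ i, o.dec = some i → c i ≠ 0)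
    (he : ∀ i, c' i + one o.dec i = c i + one o.inc i) :
    Leads ins p₀ r₀ n (x, 0, c) (y, 0, c') :=
  ⟨o, h, hz, hd, he, fun e => absurd e hx, fun e => absurd e hx',
    fun e => e.elim (fun e => absurd e hx) fun e => absurd e hx'⟩

/-- A configuration outside the loading of the input. -/
abbrev config (x : State P) (c : Counter R → ℕ) : State P × ℕ × (Counter R → ℕ) := (x, 0, c)

theorem leads_copy (f i g g' : ℕ) :
    ReflTransGen (Leads ins p₀ r₀ n) (config copy (counters f 0 i 0 g g'))
      (config copy (counters (f + g) 0 i 0 0 (g' + g))) := by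
  induction g generalizing f g' with
  | zero => exact .refl
  | succ g ih =>
    have h1 : Leads ins p₀ r₀ n (config copy (counters f 0 i 0 (g + 1) g'))
        (config copyAux (counters f 0 i 0 g (g' + 1))) := by
      refine .of_tr .copy (by simp) (by simp) (by simp) (by simp [counters]) ?_
      rintro (_ | _ | _ | _ | _ | _) <;> simp [counters, one]
    have h2 : Leads ins p₀ r₀ n (config copyAux (counters f 0 i 0 g (g' + 1)))
        (config copy (counters (f + 1) 0 i 0 g (g' + 1))) := by
      refine .of_tr .copyAux (by simp) (by simp) (by simp) (by simp) ?_
      rintro (_ | _ | _ | _ | _ | _) <;> simp [counters, one]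
    have h3 := ih (f + 1) (g' + 1)
    rw [show f + 1 + g = f + (g + 1) by omega, show g' + 1 + g = g' + (g + 1) by omega] at h3
    exact .head h1 (.head h2 h3)

theorem leads_extra (f i g g' k : ℕ) :
    ReflTransGen (Leads ins p₀ r₀ n) (config restore (counters f 0 i 0 g g'))
      (config restore (counters (f + k) 0 i 0 g g')) := by
  induction k with
  | zero => exact .refl
  | succ k ih =>
    refine .tail ih (.of_tr .extra (by simp) (by simp) (by simp) (by simp) ?_)
    rintro (_ | _ | _ | _ | _ | _) <;> simp [counters, one, add_assoc]

theorem leads_restore (f i g g' : ℕ) :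
    ReflTransGen (Leads ins p₀ r₀ n) (config restore (counters f 0 i 0 g g'))
      (config restore (counters f 0 i 0 (g + g') 0)) := by
  induction g' generalizing g with
  | zero => exact .refl
  | succ g' ih =>
    have h3 := ih (g + 1)
    rw [show g + 1 + g' = g + (g' + 1) by omega] at h3
    refine .head (.of_tr .restore (by simp) (by simp) (by simp) (by simp [counters]) ?_) h3
    rintro (_ | _ | _ | _ | _ | _) <;> simp [counters, one]

/-- The `n - i` extra tokens bring free and input tokens together to `g + n` when `i ≤ n`. -/
theorem leads_spread_of_done (i g : ℕ) :
    ReflTransGen (Leads ins p₀ r₀ n) (config done (counters 0 0 i 0 g 0))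
      (config spread (counters (g + (n - i)) 0 i 0 (g + 1) 0)) := by
  have h1 : Leads ins p₀ r₀ n (config done (counters 0 0 i 0 g 0))
      (config copy (counters 0 0 i 0 g 0)) :=
    .of_tr .begin (by simp) (by simp) (by simp) (by simp) (by simp [one])
  have h2 := leads_copy (ins := ins) (p₀ := p₀) (r₀ := r₀) (n := n) 0 i g 0
  rw [zero_add] at h2
  have h3 : Leads ins p₀ r₀ n (config copy (counters g 0 i 0 0 g))
      (config restore (counters g 0 i 0 0 g)) :=
    .of_tr .copied (by simp) (by simp) (by simp [counters]) (by simp) (by simp [one])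
  have h4 := leads_extra (ins := ins) (p₀ := p₀) (r₀ := r₀) (n := n) g i 0 g (n - i)
  have h5 := leads_restore (ins := ins) (p₀ := p₀) (r₀ := r₀) (n := n) (g + (n - i)) i 0 g
  rw [zero_add] at h5
  refine .head h1 (h2.trans (.head h3 (h4.trans (h5.tail ?_))))
  refine .of_tr .restored (by simp) (by simp) (by simp [counters]) (by simp) ?_
  rintro (_ | _ | _ | _ | _ | _) <;> simp [counters, one]

theorem leads_spreadInput (f i g : ℕ) :
    ReflTransGen (Leads ins p₀ r₀ n) (config spread (counters f 0 i 0 g 0))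
      (config spread (counters (f + i) 0 0 0 g 0)) := by
  induction i generalizing f with
  | zero => exact .refl
  | succ i ih =>
    have h3 := ih (f + 1)
    rw [show f + 1 + i = f + (i + 1) by omega] at h3
    refine .head (.of_tr .spreadInput (by simp) (by simp) (by simp) (by simp [counters]) ?_) h3
    rintro (_ | _ | _ | _ | _ | _) <;> simp [counters, one]

theorem leads_spreadUsed (f u g : ℕ) :
    ReflTransGen (Leads ins p₀ r₀ n) (config spread (counters (f + u) 0 0 0 g 0))
      (config spread (counters f u 0 0 g 0)) := by
  induction u generalizing f with
  | zero => exact .refl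
  | succ u ih =>
    have h3 := ih (f + 1)
    rw [show f + 1 + u = f + (u + 1) by omega] at h3
    refine .tail h3 (.of_tr .spreadUsed (by simp) (by simp) (by simp) (by simp [counters]) ?_)
    rintro (_ | _ | _ | _ | _ | _) <;> simp [counters, one]

theorem sum_update [Fintype R] [DecidableEq R] (s : R → ℕ) (i : R) (a : ℕ) :
    ∑ j, Function.update s i a j + s i = ∑ j, s j + a := by
  have h1 := Finset.add_sum_erase Finset.univ s (Finset.mem_univ i)
  have h2 := Finset.add_sum_erase Finset.univ (Function.update s i a) (Finset.mem_univ i)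
  have h3 : ∑ j ∈ Finset.univ.erase i, Function.update s i a j =
      ∑ j ∈ Finset.univ.erase i, s j := Finset.sum_congr rfl fun j hj => by
    rw [Function.update_of_ne (Finset.ne_of_mem_erase hj)]
  rw [Function.update_self] at h2
  omega

theorem leads_spread [Fintype R] (f u g : ℕ) (s : R → ℕ) :
    ReflTransGen (Leads ins p₀ r₀ n) (config spread (counters (f + u + ∑ i, s i) 0 0 0 g 0))
      (config spread (counters f u 0 s g 0)) := by
  classical
  induction hm : ∑ i, s i generalizing f s with
  | zero =>
    have : s = 0 := funext fun i => Finset.sum_eq_zero_iff.1 hm i (Finset.mem_univ i)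
    subst this
    exact leads_spreadUsed f u g
  | succ m ih =>
    obtain ⟨i, -, hi⟩ : ∃ i ∈ Finset.univ, s i ≠ 0 := by
      by_contra! h
      rw [Finset.sum_eq_zero h] at hm
      omega
    have hs : ∑ j, Function.update s i (s i - 1) j = m := by
      have := sum_update s i (s i - 1)
      omega
    have h3 := ih (f + 1) _ hs
    rw [show f + 1 + u + m = f + u + (m + 1) by omega] at h3
    refine .tail h3 (.of_tr (.spreadReg i) (by simp) (by simp) (by simp) (by simp [counters]) ?_)
    rintro (_ | _ | _ | _ | _ | k)
    · simp [counters, one]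
    · simp [counters, one]
    · simp [counters, one]
    · simp [counters, one]
    · simp [counters, one]
    · by_cases hk : i = k
      · subst hk
        simp [counters, one]
        omega
      · simp [counters, one, hk, Function.update_of_ne (Ne.symm hk)]

/-- Follow the machine from `(p, s)` until the free tokens are exhausted, and traverse that
computation backwards from a suitable guess in `spread`. Increments and zero tests consume a free
token and decrements lower the register sum, so `2 * f + ∑ i, s i` decreases. Divergence guarantees
a next program point. -/
theorem leads_sim [Fintype R] (f u g : ℕ) (p : P) (s : R → ℕ) (h : ¬ Halts ins (some p, s)) :
    ReflTransGen (Leads ins p₀ r₀ n) (config spread (counters (f + u + ∑ i, s i) 0 0 0 g 0))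
      (config (sim p) (counters f u 0 s g 0)) := by
  classical
  induction hm : 2 * f + ∑ i, s i using Nat.strong_induction_on generalizing f u s p with
  | _ m ih =>
  subst hm
  cases f with
  | zero =>
    refine (leads_spread 0 u g s).tail (.of_tr (.sim p) (by simp) (by simp) ?_ (by simp) ?_)
    · simp [counters]
    · simp [one]
  | succ f =>
    rw [← halts_step_iff] at h
    cases hp : ins p with
    | inc i x =>
      simp only [step, hp] at h
      obtain _ | p' := x
      · exact absurd ⟨0, rfl⟩ h
      have hs := sum_update s i (s i + 1)
      have h1 := ih _ (by omega) f u p' _ h rfl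
      rw [show f + u + ∑ j, Function.update s i (s i + 1) j = f + 1 + u + ∑ j, s j by omega] at h1
      refine h1.tail (.of_tr (.inc hp) (by simp) (by simp) (by simp) (by simp [counters]) ?_)
      rintro (_ | _ | _ | _ | _ | k)
      · simp [counters, one]
      · simp [counters, one]
      · simp [counters, one]
      · simp [counters, one]
      · simp [counters, one]
      · by_cases hk : i = k
        · subst hk
          simp [counters, one]
        · simp [counters, one, hk, Function.update_of_ne (Ne.symm hk)]
    | dec i x y =>
      simp only [step, hp] at h
      split_ifs at h with h0
      · obtain _ | p' := y
        · exact absurd ⟨0, rfl⟩ h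
        have h1 := ih _ (by omega) f (u + 1) p' _ h rfl
        rw [show f + (u + 1) + ∑ j, s j = f + 1 + u + ∑ j, s j by omega] at h1
        refine h1.tail (.of_tr (.zero hp) (by simp) (by simp) (by simp [counters, h0])
          (by simp [counters]) ?_)
        rintro (_ | _ | _ | _ | _ | k) <;> simp [counters, one]
      · obtain _ | p' := x
        · exact absurd ⟨0, rfl⟩ h
        have hs := sum_update s i (s i - 1)
        have h1 := ih _ (by omega) (f + 1) (u + 1) p' _ h rfl
        rw [show f + 1 + (u + 1) + ∑ j, Function.update s i (s i - 1) j =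
          f + 1 + u + ∑ j, s j by omega] at h1
        refine h1.tail (.of_tr (.dec hp) (by simp) (by simp) (by simp) (by simp [counters]) ?_)
        rintro (_ | _ | _ | _ | _ | k)
        · simp [counters, one]
        · simp [counters, one]
        · simp [counters, one]
        · simp [counters, one]
        · simp [counters, one]
        · by_cases hk : i = k
          · subst hk
            simp [counters, one]
            omega
          · simp [counters, one, hk, Function.update_of_ne (Ne.symm hk)]

theorem leads_load [DecidableEq R] (f i g k : ℕ) :
    ReflTransGen (Leads ins p₀ r₀ n)
      (if k = 0 then loaded else load, k, counters f 0 i (Function.update 0 r₀ k) g 0)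
      (config loaded (counters f 0 (i + k) 0 g 0)) := by
  induction k generalizing i with
  | zero => simp [ReflTransGen.refl]
  | succ k ih =>
    have h1 := ih (i + 1)
    rw [show i + 1 + k = i + (k + 1) by omega] at h1
    refine .head ⟨⟨∅, some (work (reg r₀)), some (work input)⟩, ?_, by simp, by simp [counters], ?_,
      by simp, by simp, by simp⟩ h1
    · by_cases hk : k = 0
      · simpa [hk] using .loadLoaded
      · simpa [hk] using .load
    · rintro (_ | _ | _ | _ | _ | j)
      · simp [counters, one]
      · simp [counters, one]
      · simp [counters, one]
      · simp [counters, one]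
      · simp [counters, one]
      · by_cases hj : r₀ = j
        · subst hj
          simp [counters, one]
        · simp [counters, one, hj, Function.update_of_ne (Ne.symm hj)]

theorem leads_loaded_of_spread [Fintype R] [DecidableEq R] (f g : ℕ)
    (h : ¬ Halts ins (some p₀, Function.update 0 r₀ n)) :
    ReflTransGen (Leads ins p₀ r₀ n) (config spread (counters (f + n) 0 0 0 g 0))
      (config loaded (counters f 0 n 0 g 0)) := by
  have h1 := leads_sim (r₀ := r₀) (p₀ := p₀) (n := n) f 0 g p₀ _ h
  have hs := sum_update (0 : R → ℕ) r₀ n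
  simp only [Pi.zero_apply, Finset.sum_const_zero, add_zero, zero_add] at hs h1
  rw [hs] at h1
  have h2 : Leads ins p₀ r₀ n (config (sim p₀) (counters f 0 0 (Function.update 0 r₀ n) g 0))
      (config enter (counters f 0 0 (Function.update 0 r₀ n) g 0)) :=
    .of_tr .enter (by simp) (by simp) (by simp [counters]) (by simp) (by simp [one])
  have h3 := leads_load (ins := ins) (p₀ := p₀) (r₀ := r₀) (n := n) f 0 g n
  rw [zero_add] at h3
  refine (h1.tail h2).trans (.head ⟨⟨∅, none, none⟩, ?_, by simp, by simp, by simp [one], by simp,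
    by simp, by simp⟩ h3)
  by_cases hn : n = 0
  · simpa [hn] using .enterLoaded
  · simpa [hn] using .enterLoad

/-- Each round returns the `n` input tokens and `again` discards one of the others, so `f + 1`
simulations lead to `done`. -/
theorem leads_done_of_spread [Fintype R] [DecidableEq R] (f g : ℕ)
    (h : ¬ Halts ins (some p₀, Function.update 0 r₀ n)) :
    TransGen (Leads ins p₀ r₀ n) (config spread (counters (f + n) 0 0 0 g 0))
      (config done (counters 0 0 n 0 g 0)) := by
  induction f with
  | zero =>
    refine .tail' (leads_loaded_of_spread 0 g h)
      (.of_tr .done (by simp) (by simp) ?_ (by simp) (by simp [one]))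
    rintro i (rfl | rfl | ⟨k, rfl⟩) <;> rfl
  | succ f ih =>
    refine .trans_right (leads_loaded_of_spread (f + 1) g h) (.head (.of_tr .again (by simp)
      (by simp) ?_ (by simp [counters]) ?_) (.trans_right (leads_spreadInput f n g) ih))
    · rintro i (rfl | ⟨k, rfl⟩) <;> rfl
    · rintro (_ | _ | _ | _ | _ | _) <;> simp [counters, one]

theorem leads_done_of_done [Fintype R] [DecidableEq R] {i : ℕ} (hi : i ≤ n) (g : ℕ)
    (h : ¬ Halts ins (some p₀, Function.update 0 r₀ n)) :
    TransGen (Leads ins p₀ r₀ n) (config done (counters 0 0 i 0 g 0))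
      (config done (counters 0 0 n 0 (g + 1) 0)) := by
  have h1 := leads_spreadInput (ins := ins) (p₀ := p₀) (r₀ := r₀) (n := n) (g + (n - i)) i (g + 1)
  rw [show g + (n - i) + i = g + n by omega] at h1
  exact .trans_right ((leads_spread_of_done i g).trans h1) (leads_done_of_spread g (g + 1) h)

/-- If the machine does not halt, then there are infinitely many phases. -/
theorem exists_isExactRun [Finite R] [DecidableEq R]
    (h : ¬ Halts ins (some p₀, Function.update 0 r₀ n)) :
    ∃ q o c, IsExactRun (Tr ins p₀ r₀) q o c ∧ IsFair enter load loaded done n q := by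
  cases nonempty_fintype R
  obtain ⟨f, h0, hstep, hrec⟩ := exists_infinite_path (r := Leads ins p₀ r₀ n)
    -- The first phase finds an empty input place; all later ones find the `n` tokens left by their
    -- predecessor.
    (σ := fun g => (config done (counters 0 0 (if g = 0 then 0 else n) 0 g 0))) fun g => by
      simpa using leads_done_of_done (i := if g = 0 then 0 else n) (by split_ifs <;> omega) g h
  choose o ho using hstep
  refine ⟨fun t => (f t).1, o, fun t => (f t).2.2, ⟨fun t => (ho t).tr, fun t => (ho t).zero,
    fun t => (ho t).dec, fun t => (ho t).eq, ?_⟩, ⟨?_, ?_⟩⟩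
  · rw [h0]
    rintro (_ | _ | _ | _ | _ | _) <;> simp [counters]
  · intro t
    obtain ⟨t', ht', g, hg⟩ := hrec t
    exact ⟨t', ht', by rw [hg]⟩
  · intro t ht
    have key : ∀ j ≤ n, (f (t + 1 + j)).2.1 = n - j ∧
        (f (t + 1 + j)).1 = if n - j = 0 then loaded else load := by
      intro j
      induction j with
      | zero =>
        intro _
        have h1 := (ho t).enter ht
        have h2 := (ho t).stay (.inl ht)
        rw [h1] at h2
        exact ⟨h1, h2⟩
      | succ j ih =>
        intro hj
        obtain ⟨h1, h2⟩ := ih (by omega)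
        rw [if_neg (by omega)] at h2
        have h3 := (ho (t + 1 + j)).load h2
        have h4 := (ho (t + 1 + j)).stay (.inr h2)
        have h5 : (f (t + 1 + j + 1)).2.1 = n - (j + 1) := by omega
        rw [h5] at h4
        exact ⟨h5, h4⟩
    refine ⟨fun j hj => ?_, ?_⟩
    · rw [(key j hj.le).2, if_neg (by omega)]
    · rw [(key n le_rfl).2, if_pos (by omega)]

end Backward

/-! ### Counter programs -/

namespace CounterMachine

open Function

/-- Structured counter programs; `loop i p` repeats "decrement the register `i` and run `p`" until
the register `i` is zero. -/
inductive Prog : Type where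
  | skip
  | inc (i : ℕ)
  | seq (p q : Prog)
  | loop (i : ℕ) (p : Prog)

namespace Prog

inductive Run : Prog → (ℕ → ℕ) → (ℕ → ℕ) → Prop
  | skip (s : ℕ → ℕ) : Run skip s s
  | inc (i : ℕ) (s : ℕ → ℕ) : Run (inc i) s (update s i (s i + 1))
  | seq {p q : Prog} {s s' s'' : ℕ → ℕ} (h : Run p s s') (h' : Run q s' s'') :
      Run (seq p q) s s''
  | exit {i : ℕ} {p : Prog} {s : ℕ → ℕ} (h : s i = 0) : Run (loop i p) s s
  | loop {i : ℕ} {p : Prog} {s s' s'' : ℕ → ℕ} (h : s i ≠ 0)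
      (h' : Run p (update s i (s i - 1)) s') (h'' : Run (loop i p) s' s'') :
      Run (loop i p) s s''

theorem Run.congr {p : Prog} {s s' s'' : ℕ → ℕ} (h : Run p s s') (e : s' = s'') : Run p s s'' :=
  e ▸ h

theorem run_clear (i : ℕ) (s : ℕ → ℕ) : Run (loop i skip) s (update s i 0) := by
  induction h : s i generalizing s with
  | zero => exact (Run.exit h).congr (by rw [← h, update_eq_self])
  | succ m ih =>
    have h1 := ih (update s i m) (by simp)
    rw [update_idem] at h1
    exact .loop (by omega) (by rw [h]; exact .skip _) h1

theorem run_move {i o : ℕ} (hio : i ≠ o) (s : ℕ → ℕ) :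
    Run (loop i (inc o)) s (update (update s o (s o + s i)) i 0) := by
  induction h : s i generalizing s with
  | zero => exact (Run.exit h).congr (by grind)
  | succ m ih =>
    have h1 := ih (update (update s i m) o (s o + 1)) (by grind)
    refine .loop (by omega) (.inc o _) ?_
    have h2 : update (update s i (s i - 1)) o (update s i (s i - 1) o + 1) =
      update (update s i m) o (s o + 1) := by grind
    rw [h2]
    exact h1.congr (by grind)

theorem run_move_both {i o t : ℕ} (hio : i ≠ o) (hit : i ≠ t) (hot : o ≠ t) (s : ℕ → ℕ) :
    Run (loop i (seq (inc o) (inc t))) s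
      (update (update (update s o (s o + s i)) t (s t + s i)) i 0) := by
  induction h : s i generalizing s with
  | zero => exact (Run.exit h).congr (by grind)
  | succ m ih =>
    have h1 := ih (update (update (update s i m) o (s o + 1)) t (s t + 1)) (by grind)
    refine .loop (by omega) (.seq (.inc o _) (.inc t _)) ?_
    have h2 : update (update (update s i (s i - 1)) o (update s i (s i - 1) o + 1)) t
        (update (update s i (s i - 1)) o (update s i (s i - 1) o + 1) t + 1) =
      update (update (update s i m) o (s o + 1)) t (s t + 1) := by grind
    rw [h2]
    exact h1.congr (by grind)

/-- Copy the register `i` to `o`, using the register `t`. -/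
def copy (i o t : ℕ) : Prog :=
  seq (loop o skip) (seq (loop i (seq (inc o) (inc t))) (loop t (inc i)))

theorem run_copy {i o t : ℕ} (hio : i ≠ o) (hit : i ≠ t) (hot : o ≠ t) {s : ℕ → ℕ} (ht : s t = 0) :
    Run (copy i o t) s (update s o (s i)) := by
  refine .seq (run_clear o s) (.seq (run_move_both hio hit hot _) ((run_move hit.symm _).congr ?_))
  grind

/-- The program `p` computes the function `f` of the registers `xs` into the register `o`, and uses
the registers from `b` on, which are zero before and afterwards. -/
def Computes {n : ℕ} (p : Prog) (f : List.Vector ℕ n → ℕ) (xs : Fin n → ℕ) (o b : ℕ) : Prop :=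
  ∀ s : ℕ → ℕ, (∀ j, b ≤ j → s j = 0) →
    Run p s (update s o (f (List.Vector.ofFn fun i => s (xs i))))

/-- The results go to registers from `b` on, while the arguments lie below `b` and remain intact for
the next program. -/
theorem exists_run_all {n m : ℕ} {g : Fin n → List.Vector ℕ m → ℕ} {xs : Fin m → ℕ} {b : ℕ}
    (hxs : ∀ i, xs i < b) (hg : ∀ i, ∀ o, b ≤ o → o < b + n → ∃ p, Computes p (g i) xs o (b + n))
    (k : ℕ) (hk : k ≤ n) : ∃ p, ∀ s : ℕ → ℕ, (∀ j, b ≤ j → s j = 0) →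
      Run p s (fun j => if h : b ≤ j ∧ j < b + k then
        g ⟨j - b, by omega⟩ (List.Vector.ofFn fun i => s (xs i)) else s j) := by
  induction k with
  | zero => exact ⟨skip, fun s _ => (Run.skip s).congr (by funext j; rw [dif_neg (by omega)])⟩
  | succ k ih =>
    obtain ⟨p, hp⟩ := ih (by omega)
    obtain ⟨p', hp'⟩ := hg ⟨k, by omega⟩ (b + k) (by omega) (by omega)
    refine ⟨seq p p', fun s hs => .seq (hp s hs) ((hp' _ fun j hj => ?_).congr ?_)⟩
    · rw [dif_neg (by omega)]
      exact hs j (by omega)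
    · funext j
      have e : (fun i => if h : b ≤ xs i ∧ xs i < b + k then
          g ⟨xs i - b, by omega⟩ (List.Vector.ofFn fun i => s (xs i)) else s (xs i)) =
          fun i => s (xs i) := by
        funext i
        rw [dif_neg (by have := hxs i; omega)]
      rw [e]
      by_cases hj : j = b + k
      · subst hj
        simp
      · rw [update_of_ne hj]
        by_cases h : b ≤ j ∧ j < b + k
        · rw [dif_pos h, dif_pos ⟨h.1, by omega⟩]
        · rw [dif_neg h, dif_neg (by omega)]

theorem exists_run_clear_all (b n : ℕ) : ∃ p, ∀ s : ℕ → ℕ,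
    Run p s (fun j => if b ≤ j ∧ j < b + n then 0 else s j) := by
  induction n with
  | zero => exact ⟨skip, fun s => (Run.skip s).congr (by funext j; rw [if_neg (by omega)])⟩
  | succ n ih =>
    obtain ⟨p, hp⟩ := ih
    refine ⟨seq p (loop (b + n) skip), fun s => .seq (hp s) ((run_clear _ _).congr ?_)⟩
    funext j
    by_cases hj : j = b + n
    · subst hj
      simp
    · rw [update_of_ne hj]
      congr 1
      simp only [eq_iff_iff]
      omega

theorem exists_computes_comp {n m : ℕ} {f : List.Vector ℕ n → ℕ} {g : Fin n → List.Vector ℕ m → ℕ}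
    {xs : Fin m → ℕ} {o b : ℕ} (hxs : ∀ i, xs i < b) (ho : o < b)
    (hf : ∃ p, Computes p f (fun i => b + i) o (b + n))
    (hg : ∀ i, ∀ o, b ≤ o → o < b + n → ∃ p, Computes p (g i) xs o (b + n)) :
    ∃ p, Computes p (fun v => f (List.Vector.ofFn fun i => g i v)) xs o b := by
  obtain ⟨p, hp⟩ := exists_run_all hxs hg n le_rfl
  obtain ⟨p', hp'⟩ := hf
  obtain ⟨p'', hp''⟩ := exists_run_clear_all b n
  refine ⟨seq p (seq p' p''), fun s hs => .seq (hp s hs) (.seq (hp' _ fun j hj => ?_)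
    ((hp'' _).congr ?_))⟩
  · rw [dif_neg (by omega)]
    exact hs j (by omega)
  · funext j
    by_cases hj : b ≤ j ∧ j < b + n
    · rw [if_pos hj, update_of_ne (by omega), hs j hj.1]
    · rw [if_neg hj]
      by_cases hjo : j = o
      · subst hjo
        simp
      · rw [update_of_ne hjo, update_of_ne hjo, dif_neg hj]

/-- Register `b` counts the remaining rounds, `b + 1` the completed ones, `b + 2` holds the current
value and `b + 3` receives the next. In the proof, `S m k` is the store with `m` rounds left and `k`
done. -/
theorem exists_computes_prec {n : ℕ} {f : List.Vector ℕ n → ℕ} {g : List.Vector ℕ (n + 2) → ℕ}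
    {xs : Fin (n + 1) → ℕ} {o b : ℕ} (hxs : ∀ i, xs i < b) (ho : o < b)
    (hf : ∃ p, Computes p f (fun i => xs i.succ) (b + 2) (b + 4))
    (hg : ∃ p, Computes p g (Fin.cons (b + 1) (Fin.cons (b + 2) fun i => xs i.succ))
      (b + 3) (b + 4)) :
    ∃ p, Computes p (fun v : List.Vector ℕ (n + 1) =>
      v.head.rec (f v.tail) fun y IH => g (y ::ᵥ IH ::ᵥ v.tail)) xs o b := by
  obtain ⟨pf, hpf⟩ := hf
  obtain ⟨pg, hpg⟩ := hg
  let body := seq pg (seq (loop (b + 2) skip) (seq (loop (b + 3) (inc (b + 2))) (inc (b + 1))))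
  refine ⟨seq (copy (xs 0) b (b + 1)) (seq pf (seq (loop b body)
    (seq (loop o skip) (seq (loop (b + 2) (inc o)) (loop (b + 1) skip))))), fun s hs => ?_⟩
  let w : List.Vector ℕ n := List.Vector.ofFn fun i => s (xs i.succ)
  let r : ℕ → ℕ := fun k => k.rec (f w) fun y IH => g (y ::ᵥ IH ::ᵥ w)
  let S : ℕ → ℕ → ℕ → ℕ := fun m k => update (update (update s b m) (b + 1) k) (b + 2) (r k)
  have hS : ∀ m k j, j < b → S m k j = s j := fun m k j hj => by
    simp only [S]
    rw [update_of_ne (by omega), update_of_ne (by omega), update_of_ne (by omega)]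
  have hS' : ∀ m k j, b + 3 ≤ j → S m k j = 0 := fun m k j hj => by
    simp only [S]
    rw [update_of_ne (by omega), update_of_ne (by omega), update_of_ne (by omega)]
    exact hs j (by omega)
  have hbody : ∀ m k, Run body (S m k) (S m (k + 1)) := fun m k => by
    have h1 := hpg (S m k) fun j hj => hS' m k j (by omega)
    have e : (List.Vector.ofFn fun i => S m k
        ((Fin.cons (b + 1) (Fin.cons (b + 2) fun i => xs i.succ) : Fin (n + 2) → ℕ) i)) =
        k ::ᵥ r k ::ᵥ w := by
      rw [List.Vector.ofFn, List.Vector.ofFn]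
      simp only [Fin.cons_zero, Fin.cons_succ]
      have e1 : S m k (b + 1) = k := by simp [S]
      have e2 : S m k (b + 2) = r k := by simp [S]
      have e3 : (fun i : Fin n => S m k (xs i.succ)) = fun i => s (xs i.succ) :=
        funext fun i => hS m k _ (hxs _)
      rw [e1, e2, e3]
    rw [e] at h1
    have e4 : S m k (b + 3) = 0 := hS' m k _ le_rfl
    refine .seq h1 (.seq (run_clear _ _) (.seq (run_move (by omega) _) ((Run.inc _ _).congr ?_)))
    have e5 : r (k + 1) = g (k ::ᵥ r k ::ᵥ w) := rfl
    have e6 : s (b + 3) = 0 := hs _ (by omega)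
    rw [← e5]
    clear_value r
    simp only [S]
    grind
  have hloop : ∀ m k, Run (loop b body) (S m k) (S 0 (k + m)) := by
    intro m
    induction m with
    | zero => exact fun k => .exit (by simp [S])
    | succ m ih =>
      intro k
      have h1 : S (m + 1) k b = m + 1 := by simp [S]
      refine .loop (s' := S m (k + 1)) (by omega) ?_ ?_
      · have h2 : update (S (m + 1) k) b (S (m + 1) k b - 1) = S m k := by
          rw [h1]
          clear_value r
          simp only [S]
          grind
        rw [h2]
        exact hbody m k
      · have := ih (k + 1)
        rwa [show k + 1 + m = k + (m + 1) by omega] at this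
  have h1 := run_copy (i := xs 0) (o := b) (t := b + 1) (by have := hxs 0; omega)
    (by have := hxs 0; omega) (by omega) (hs _ (by omega))
  have h2 := hpf (update s b (s (xs 0))) fun j hj => by
    rw [update_of_ne (by omega)]
    exact hs j (by omega)
  have e : (fun i : Fin n => update s b (s (xs 0)) (xs i.succ)) = fun i => s (xs i.succ) :=
    funext fun i => update_of_ne (by have := hxs i.succ; omega) _ _
  rw [e] at h2
  have h3 := hloop (s (xs 0)) 0
  have e2 : S (s (xs 0)) 0 = update (update s b (s (xs 0))) (b + 2) (f w) := by
    have := hs (b + 1) (by omega)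
    have e3 : r 0 = f w := rfl
    simp only [S, e3]
    clear_value r
    grind
  rw [e2, zero_add] at h3
  refine .seq h1 (.seq h2 (.seq h3 (.seq (run_clear _ _) (.seq (run_move (by omega) _)
    ((run_clear _ _).congr ?_)))))
  have e4 : (List.Vector.ofFn fun i => s (xs i)).tail = w := by
    rw [List.Vector.ofFn, List.Vector.tail_cons]
  have e5 : (List.Vector.ofFn fun i => s (xs i)).head = s (xs 0) := by
    rw [List.Vector.ofFn, List.Vector.head_cons]
  beta_reduce
  rw [e4, e5]
  have e6 : (Nat.rec (f w) (fun y IH => g (y ::ᵥ IH ::ᵥ w)) (s (xs 0)) : ℕ) = r (s (xs 0)) := rfl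
  rw [e6]
  have e7 := hs b le_rfl
  have e8 := hs (b + 1) (by omega)
  have e9 := hs (b + 2) (by omega)
  clear_value r
  simp only [S]
  grind

theorem exists_computes {n : ℕ} {f : List.Vector ℕ n → ℕ} (hf : Nat.Primrec' f)
    (xs : Fin n → ℕ) (o b : ℕ) (hxs : ∀ i, xs i < b) (ho : o < b) (hne : ∀ i, xs i ≠ o) :
    ∃ p, Computes p f xs o b := by
  induction hf generalizing o b with
  | zero => exact ⟨loop o skip, fun s _ => run_clear o s⟩
  | succ =>
    refine ⟨seq (copy (xs 0) o b) (inc o), fun s hs => ?_⟩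
    refine .seq (run_copy (hne 0) (hxs 0).ne ho.ne (hs b le_rfl)) ((Run.inc _ _).congr ?_)
    simp [List.Vector.ofFn]
  | get i =>
    refine ⟨copy (xs i) o b, fun s hs => ?_⟩
    refine (run_copy (hne i) (hxs i).ne ho.ne (hs b le_rfl)).congr ?_
    simp
  | @comp m n f g _ _ ihf ihg =>
    refine exists_computes_comp hxs ho (ihf _ _ _ (fun i => by omega) (by omega)
      fun i => by omega) fun i o ho ho' => ihg i _ _ _ (fun j => (hxs j).trans_le (by omega)) ho'
        fun j => by have := hxs j; omega
  | @prec n f g _ _ ihf ihg =>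
    refine exists_computes_prec hxs ho (ihf _ _ _ (fun i => ?_) (by omega) fun i => ?_)
      (ihg _ _ _ (fun i => ?_) (by omega) fun i => ?_)
    · have := hxs i.succ; omega
    · have := hxs i.succ; omega
    · refine Fin.cases ?_ (fun i => Fin.cases ?_ (fun i => ?_) i) i
      · simp
      · simp
      · have := hxs i.succ
        simp only [Fin.cons_succ]
        omega
    · refine Fin.cases ?_ (fun i => Fin.cases ?_ (fun i => ?_) i) i
      · simp
      · simp
      · have := hxs i.succ
        simp only [Fin.cons_succ]
        omega

end Prog

end CounterMachine

/-! ### Compiling counter programs -/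

namespace CounterMachine

open Function

namespace Prog

/-- The points of a program at which an instruction is executed. -/
def Point : Prog → Type
  | skip => Empty
  | inc _ => Unit
  | seq p q => Point p ⊕ Point q
  | loop _ p => Option (Point p)

instance finite_point : (p : Prog) → Finite (Point p)
  | skip => inferInstanceAs (Finite Empty)
  | inc _ => inferInstanceAs (Finite Unit)
  | seq p q =>
    have := finite_point p
    have := finite_point q
    inferInstanceAs (Finite (Point p ⊕ Point q))
  | loop _ p =>
    have := finite_point p
    inferInstanceAs (Finite (Option (Point p)))

variable {P : Type}

/-- The entry point of a program with points embedded by `e` and exit `x`. -/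
def entry : (p : Prog) → (Point p → P) → Option P → Option P
  | skip, _, x => x
  | inc _, e, _ => some (e ())
  | seq p q, e, x => entry p (fun a => e (.inl a)) (entry q (fun a => e (.inr a)) x)
  | loop _ _, e, _ => some (e none)

/-- The instructions of a program with points embedded by `e` and exit `x`. -/
def code : (p : Prog) → (Point p → P) → Option P → Point p → Instr P ℕ
  | skip, _, _, a => nomatch a
  | inc i, _, x, _ => .inc i x
  | seq p q, e, x, a =>
    match a with
    | .inl a => code p (fun a => e (.inl a)) (entry q (fun a => e (.inr a)) x) a
    | .inr a => code q (fun a => e (.inr a)) x a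
  | loop i p, e, x, a =>
    match a with
    | none => .dec i (entry p (fun a => e (some a)) (some (e none))) x
    | some a => code p (fun a => e (some a)) (some (e none)) a

theorem Run.exists_iterate {p : Prog} {s s' : ℕ → ℕ} (h : Run p s s') {ins : P → Instr P ℕ}
    {e : Point p → P} {x : Option P} (hins : ∀ a, ins (e a) = code p e x a) :
    ∃ j, (step ins)^[j] (entry p e x, s) = (x, s') := by
  induction h generalizing x with
  | skip s => exact ⟨0, rfl⟩
  | inc i s =>
    refine ⟨1, ?_⟩
    have := hins ()
    simp only [code] at this
    simp only [iterate_one, entry, step, this, Prod.mk.injEq, true_and]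
    grind
  | seq _ _ ih ih' =>
    obtain ⟨j, hj⟩ := ih (e := fun a => e (.inl a)) fun a => hins (.inl a)
    obtain ⟨j', hj'⟩ := ih' (e := fun a => e (.inr a)) fun a => hins (.inr a)
    refine ⟨j' + j, ?_⟩
    rw [iterate_add_apply]
    simp only [entry]
    rw [hj, hj']
  | @exit i p s hs =>
    refine ⟨1, ?_⟩
    have := hins none
    simp only [code] at this
    simp only [iterate_one, entry, step, this, hs, if_true]
  | @loop i p s s' s'' hs _ _ ih ih' =>
    obtain ⟨j, hj⟩ := ih (e := fun a => e (some a)) fun a => hins (some a)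
    obtain ⟨j', hj'⟩ := ih' hins
    refine ⟨j' + (j + 1), ?_⟩
    rw [iterate_add_apply, iterate_succ_apply]
    have h1 := hins none
    simp only [code] at h1
    have h2 : step ins (entry (Prog.loop i p) e x, s) =
        (entry p (fun a => e (some a)) (some (e none)), update s i (s i - 1)) := by
      simp only [entry, step, h1, hs, if_false, Prod.mk.injEq, true_and]
      grind
    rw [h2, hj]
    exact hj'

end Prog

/-! ### Restricting the set of registers -/

def Instr.reg {P R : Type} : Instr P R → R
  | .inc i _ => i
  | .dec i _ _ => i

def Instr.map {P R R' : Type} (f : R → R') : Instr P R → Instr P R'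
  | .inc i x => .inc (f i) x
  | .dec i x y => .dec (f i) x y

/-- Every register the machine uses lies in the range of `e`, so forgetting the others commutes with
each step. -/
theorem halts_map_iff {P R R' : Type} {ins : P → Instr P R} {e : R' → R} {r : R → R'}
    (he : Injective e) (h : ∀ p, e (r (ins p).reg) = (ins p).reg) (x : Option P) (s : R → ℕ) :
    Halts (fun p => (ins p).map r) (x, fun i => s (e i)) ↔ Halts ins (x, s) := by
  classical
  have hsemi : Semiconj (fun σ : Option P × (R → ℕ) => (σ.1, fun i => σ.2 (e i)))
      (step ins) (step fun p => (ins p).map r) := by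
    rintro ⟨_ | p, s⟩
    · rfl
    · have hp := h p
      have hupd : ∀ i a, e (r i) = i →
          (fun k => update s i a (e k)) = update (fun k => s (e k)) (r i) a := by
        intro i a hi
        funext k
        by_cases hk : k = r i
        · subst hk
          simp [hi]
        · rw [update_of_ne hk, update_of_ne fun e' => hk (he (e'.trans hi.symm))]
      cases hi : ins p with
      | inc i x =>
        rw [hi] at hp
        have hp : e (r i) = i := hp
        simp only [step, hi, Instr.map, hp, Prod.mk.injEq, true_and]
        convert hupd i _ hp
      | dec i x y =>
        rw [hi] at hp
        have hp : e (r i) = i := hp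
        simp only [step, hi, Instr.map, hp]
        split_ifs with h0
        · rfl
        · simp only [Prod.mk.injEq, true_and]
          convert hupd i _ hp
  refine exists_congr fun T => ?_
  rw [← (hsemi.iterate_right T).eq (x, s)]

theorem exists_halts_restrict_iff {P : Type} [Finite P] (ins : P → Instr P ℕ) (p₀ : P) :
    ∃ (k : ℕ) (ins' : P → Instr P (Fin (k + 1))), ∀ n,
      Halts ins' (some p₀, update 0 0 n) ↔ Halts ins (some p₀, update 0 0 n) := by
  obtain ⟨k, hk⟩ := (Set.finite_range fun p => (ins p).reg).bddAbove
  refine ⟨k, fun p => (ins p).map (Fin.ofNat (k + 1)), fun n => ?_⟩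
  rw [← halts_map_iff (e := Fin.val) (r := Fin.ofNat (k + 1)) Fin.val_injective fun p =>
    Nat.mod_eq_of_lt (Nat.lt_succ_of_le (hk ⟨p, rfl⟩))]
  have : (fun i : Fin (k + 1) => update (0 : ℕ → ℕ) 0 n i.val) =
      update (0 : Fin (k + 1) → ℕ) 0 n := by
    funext i
    by_cases hi : i = 0
    · subst hi
      simp
    · have hi' : (i : ℕ) ≠ 0 := fun e => hi (Fin.ext e)
      rw [update_of_ne hi, update_of_ne hi']
      rfl
  rw [this]

/-! ### An undecidable halting problem -/

open Prog in
/-- There is a counter machine which searches for a zero of a given primitive recursive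
function. -/
theorem exists_halts_iff {f : List.Vector ℕ 2 → ℕ} (hf : Nat.Primrec' f) :
    ∃ (P : Type) (_ : Finite P) (ins : P → Instr P ℕ) (p₀ : P), ∀ n,
      Halts ins (some p₀, update 0 0 n) ↔ ∃ k, f (n ::ᵥ k ::ᵥ .nil) = 0 := by
  obtain ⟨p, hp⟩ := exists_computes hf (fun i => i) 2 3 (fun i => by omega) (by omega)
    (fun i => by omega)
  let body := seq p (inc 1)
  have hz : ∀ j, (0 : ℕ → ℕ) j = 0 := fun _ => rfl
  let S : ℕ → ℕ → ℕ → ℕ → ℕ := fun n k a => update (update (update 0 0 n) 1 k) 2 a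
  have hbody : ∀ n k a, Run body (S n k a) (S n (k + 1) (f (n ::ᵥ k ::ᵥ .nil))) := fun n k a => by
    have h1 := hp (S n k a) fun j hj => by simp only [S]; grind
    have e : (List.Vector.ofFn fun i : Fin 2 => S n k a i) = n ::ᵥ k ::ᵥ .nil := by
      simp [List.Vector.ofFn, S]
    rw [e] at h1
    refine .seq h1 ((Run.inc _ _).congr ?_)
    simp only [S]
    grind
  have hS : ∀ n k a, update (S n k (a + 1)) 2 (S n k (a + 1) 2 - 1) = S n k a := fun n k a => by
    simp only [S]
    grind
  have hinit : ∀ n, Run (inc 2) (update 0 0 n) (S n 0 1) := fun n => by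
    refine (Run.inc _ _).congr ?_
    simp only [S]
    grind
  -- Register `0` holds the input, `1` the candidate, `2` the last value of `f`. Setting register
  -- `2` to one forces the first evaluation; the decrement made by the loop is harmless because `p`
  -- overwrites that register.
  let W := seq (inc 2) (loop 2 body)
  let ins : Point W → Instr (Point W) ℕ := code W id none
  let start : Point W := .inl ()
  let head : Point W := .inr none
  let emb : Point body → Point W := fun b => .inr (some b)
  have hhead : ins head = .dec 2 (entry body emb (some head)) none := rfl
  refine ⟨Point W, inferInstance, ins, start, fun n => ⟨?_, ?_⟩⟩
  · contrapose!
    intro hne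
    -- Every round takes at least one step and ends with a non-zero value, so a halting time yields
    -- a smaller one.
    have key : ∀ T k a, ((step ins)^[T] (some head, S n k (a + 1))).1 ≠ none := by
      intro T
      induction T using Nat.strong_induction_on with
      | _ T ih =>
      intro k a hT
      obtain ⟨j, hj⟩ := (hbody n k a).exists_iterate (ins := ins) (e := emb) (x := some head)
        fun b => rfl
      have h1 : step ins (some head, S n k (a + 1)) = (entry body emb (some head), S n k a) := by
        have h3 : S n k (a + 1) 2 ≠ 0 := by simp [S]
        simp only [step, hhead, h3, if_false]
        rw [← hS n k a]
        congr!
      have h4 : (step ins)^[j + 1] (some head, S n k (a + 1)) =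
          (some head, S n (k + 1) (f (n ::ᵥ k ::ᵥ .nil))) := by
        rw [iterate_succ_apply, h1, hj]
      have hlt := lt_of_iterate_step_eq_some hT h4
      obtain ⟨d, rfl⟩ := Nat.exists_eq_add_of_le hlt.le
      obtain ⟨c, hc⟩ := Nat.exists_eq_succ_of_ne_zero (hne k)
      rw [add_comm, iterate_add_apply, h4, hc] at hT
      exact ih d (by omega) _ _ hT
    rintro ⟨T, hT⟩
    obtain ⟨j, hj⟩ := (hinit n).exists_iterate (ins := ins) (e := fun _ => start)
      (x := some head) fun b => rfl
    have hj' : (step ins)^[j] (some start, update 0 0 n) = (some head, S n 0 1) := hj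
    have hlt := lt_of_iterate_step_eq_some hT hj'
    obtain ⟨d, rfl⟩ := Nat.exists_eq_add_of_le hlt.le
    rw [add_comm, iterate_add_apply, hj'] at hT
    exact key d 0 0 hT
  · rintro ⟨k, hk⟩
    -- The search may stop at a zero before `k + d`, which is the case of value `0`; hence the
    -- unspecified final store.
    have key : ∀ d k a, f (n ::ᵥ (k + d) ::ᵥ .nil) = 0 →
        ∃ s, Run (loop 2 body) (S n k a) s := by
      intro d
      induction d with
      | zero =>
        rintro k (_ | a) h
        · exact ⟨_, .exit (by simp [S])⟩
        · refine ⟨_, .loop (by simp [S]) ((hS n k a).symm ▸ hbody n k a) (.exit ?_)⟩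
          simpa [S] using h
      | succ d ih =>
        rintro k (_ | a) h
        · exact ⟨_, .exit (by simp [S])⟩
        · obtain ⟨s, hs⟩ := ih (k + 1) (f (n ::ᵥ k ::ᵥ .nil)) (by
            rwa [show k + 1 + d = k + (d + 1) by omega])
          exact ⟨s, .loop (by simp [S]) ((hS n k a).symm ▸ hbody n k a) hs⟩
    obtain ⟨s, hs⟩ := key k 0 1 (by rwa [zero_add])
    obtain ⟨j, hj⟩ := (Run.seq (hinit n) hs).exists_iterate (ins := ins) (e := id) (x := none)
      fun b => rfl
    exact ⟨j, congrArg Prod.fst hj⟩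

/-- The halting problem of some counter machine is undecidable. -/
theorem exists_not_computablePred_halts : ∃ (P : Type) (_ : Finite P) (k : ℕ)
    (ins : P → Instr P (Fin (k + 1))) (p₀ : P),
    ¬ ComputablePred fun n => Halts ins (some p₀, update 0 0 n) := by
  -- A zero at `(n, k)` means that the code numbered `n`, run on input `0`, yields a value with
  -- bound `k`.
  let f : List.Vector ℕ 2 → ℕ := fun v =>
    if (Nat.Partrec.Code.evaln (v.get 1) (Denumerable.ofNat Nat.Partrec.Code (v.get 0)) 0).isSome
    then 0 else 1
  have hf : Primrec f := by
    have h1 : Primrec fun v : List.Vector ℕ 2 => v.get 0 :=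
      Primrec.vector_get.comp .id (.const 0)
    have h2 : Primrec fun v : List.Vector ℕ 2 => v.get 1 :=
      Primrec.vector_get.comp .id (.const 1)
    have h3 := Nat.Partrec.Code.primrec_evaln.comp
      (Primrec.pair (Primrec.pair h2 ((Primrec.ofNat Nat.Partrec.Code).comp h1)) (.const 0))
    exact (Primrec.ite (Primrec.eq.comp (Primrec.option_isSome.comp h3) (.const true))
      (.const 0) (.const 1))
  obtain ⟨P, hP, ins, p₀, h⟩ := exists_halts_iff (Nat.Primrec'.of_prim hf)
  obtain ⟨k, ins', h'⟩ := exists_halts_restrict_iff ins p₀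
  refine ⟨P, hP, k, ins', p₀, fun hc => ComputablePred.halting_problem 0 ?_⟩
  refine ComputablePred.computable_of_manyOneReducible ⟨Encodable.encode, Computable.encode, ?_⟩ hc
  intro c
  rw [h', h]
  refine Part.dom_iff_mem.trans ?_
  simp only [f, List.Vector.get_zero, List.Vector.head_cons, ite_eq_left_iff, one_ne_zero,
    imp_false,
    not_not, Denumerable.ofNat_encode, Nat.Partrec.Code.evaln_complete, Option.isSome_iff_exists]
  exact exists_comm

end CounterMachine

open CounterMachine CounterSystem in
theorem theorem6 :
    ¬ ComputablePred (fun φ : BimodalLogic.Formula =>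
        BimodalLogic.Satisfiable
          (BimodalLogic.expandingProduct {BimodalLogic.omegaFrame}
            BimodalLogic.diffFrames.{v}) φ) ∧
      ¬ ComputablePred (fun φ : FOLTL.Formula => FOLTL.ExpandingSatisfiable.{0, v} ℕ φ) := by
  have h2 : ¬ ComputablePred (fun φ : FOLTL.Formula =>
      FOLTL.ExpandingSatisfiable.{0, v} ℕ φ) := by
    obtain ⟨P, hP, k, ins, p₀, hhalt⟩ := exists_not_computablePred_halts
    -- Any numbering of these fixed finite types will do: only `n` varies in the reduction.
    let _ := Encodable.ofCountable (Backward.State P)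
    let _ := Encodable.ofCountable (Backward.Counter (Fin (k + 1)))
    intro hc
    have hred : (fun n => ¬ Halts ins (some p₀, Function.update 0 0 n)) ≤₀ fun φ : FOLTL.Formula =>
        FOLTL.ExpandingSatisfiable.{0, v} ℕ φ := by
      refine ⟨FOLTL.Formula.describe (Backward.Tr ins p₀ 0) .enter .load .loaded .done,
        (FOLTL.Formula.primrec_describe _ _ _ _ _).to_comp, fun n => ⟨fun h => ?_, fun h => ?_⟩⟩
      · obtain ⟨q, o, c, hrun, hfair⟩ := Backward.exists_isExactRun h
        exact FOLTL.expandingSatisfiable_describe hrun hfair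
      · obtain ⟨q, o, c, hrun, hfair⟩ := FOLTL.exists_isFaultyRun h
        obtain ⟨c', hc'⟩ := Backward.exists_isFaultyStep hrun hfair
        exact Backward.not_halts_of_isFair hc' hfair
    refine hhalt ((ComputablePred.computable_of_manyOneReducible hred hc).not.of_eq fun n => ?_)
    exact not_not
  refine ⟨fun hc => h2 ?_, h2⟩
  exact ComputablePred.computable_of_manyOneReducible
    ⟨FOLTL.Formula.star, FOLTL.Formula.primrec_star.to_comp,
      fun φ => (FOLTL.satisfiable_star_iff φ).symm⟩ hc
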